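/- Let $\Delta>0$ and let $q$ be the uniform quantizer $q(z)=j\Delta$ for $(j-\tfrac12)\Delta\le z<(j+\tfrac12)\Delta$, $j\in\mathbb Z$. Let $m\ge 1$, $\delta_0\in\{0,1\}$, $a_0\in\mathbb R$, and let $$r(t)=\delta_0a_0+\sum_{i=1}^m a_i\sin(\omega_it+\theta_i),\qquad a_i\neq0,\ \omega_i>0,\ \theta_i\in\mathbb R,$$ be periodic with period $T>0$. Put $\phi(t)=[\,1\ \ \sin\omega_1t\ \ \cos\omega_1t\ \cdots\ \sin\omega_mt\ \ \cos\omega_mt\,]$, let $t_1,\dots,t_p$ be all the times in $[0,T)$ at which $r$ crosses a quantization level, that is, passes from one quantization region $[(j-\frac12)\Delta,(j+\frac12)\Delta)$ to a different one, and let $\mathcal M$ be the $p\times(2m+1)$ matrix with rows $\phi(t_1),\dots,\phi(t_p)$. Suppose that $p\ge 2m+1$ and $\operatorname{rank}\mathcal M=2m+1$. Let $H(s)=C(s)G(s)$ be a proper real rational function such that (i) $H$ has a simple pole at $0$ if $\delta_0=1$; (ii) $H$ has simple poles at $\pm j\omega_i$ for $i=1,\dots,m$; (iii) all other poles of $H$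 lie in the open left half-plane; (iv) $H$ is positive real, that is, $H$ is analytic and $\operatorname{Re}H(s)\ge0$ for $\operatorname{Re}s>0$. Let $(A,B,C,D)$ be a minimal state-space realization of $H$, and let $x,\tilde e,y$ be any solution on $[0,\infty)$, with any initial state, of the loop $$\dot x=Ax+B\tilde e,\qquad y=Cx+D\tilde e,\qquad \tilde e=q(r)-q(y).$$ Solutions are understood in the sense of Filippov: $x$ is absolutely continuous, the differential equation holds almost everywhere, and when $y(t)$ lies on a quantization level $(j+\frac12)\Delta$ the value $q(y(t))$ may be replaced by any number in $[j\Delta,(j+1)\Delta]$; solutions with exactly $\tilde e=q(r)-q(y)$ are included. Then the tracking error $e(t)=r(t)-y(t)$ tends to $0$ as $t\to\infty$. -/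

import Mathlib

open Filter Topology MeasureTheory
open scoped Matrix

noncomputable section

namespace QuantTracking

/-- The quantization region `Q_j` of the uniform quantizer with interval `Δ`. -/
def region (Δ : ℝ) (j : ℤ) : Set ℝ :=
  {z : ℝ | ((j : ℝ) - 1 / 2) * Δ ≤ z ∧ z < ((j : ℝ) + 1 / 2) * Δ}

/-- The uniform quantizer with interval `Δ`. -/
def quantizer (Δ z : ℝ) : ℝ := (⌊z / Δ + 1 / 2⌋ : ℝ) * Δ

/-- `q(z) = j Δ` for all `z` in `Q_j`; this determines `q`, see `exists_mem_region`. -/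
theorem quantizer_eq_of_mem_region {Δ z : ℝ} (hΔ : 0 < Δ) {j : ℤ} (hz : z ∈ region Δ j) :
    quantizer Δ z = j * Δ := by
  obtain ⟨h1, h2⟩ := hz
  have h : ⌊z / Δ + 1 / 2⌋ = j := by
    rw [Int.floor_eq_iff]
    rw [← le_div_iff₀ hΔ] at h1
    rw [← div_lt_iff₀ hΔ] at h2
    constructor <;> linarith
  rw [quantizer, h]

/-- The quantization regions cover the real line. -/
theorem exists_mem_region {Δ : ℝ} (hΔ : 0 < Δ) (z : ℝ) : ∃ j : ℤ, z ∈ region Δ j := by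
  refine ⟨⌊z / Δ + 1 / 2⌋, ?_, ?_⟩
  · rw [← le_div_iff₀ hΔ]
    linarith [Int.floor_le (z / Δ + 1 / 2)]
  · rw [← div_lt_iff₀ hΔ]
    linarith [Int.lt_floor_add_one (z / Δ + 1 / 2)]

/-- The Filippov regularization of the quantizer: the segment between the left and the right limit
of the quantizer at `z`. It is `{q(z)}` unless `z` is a quantization level `(j + 1/2) Δ`, where it is
`[j Δ, (j + 1) Δ]`. -/
def filledQuantizer (Δ z : ℝ) : Set ℝ :=
  Set.Icc ((⌈z / Δ - 1 / 2⌉ : ℝ) * Δ) ((⌊z / Δ + 1 / 2⌋ : ℝ) * Δ)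

/-- The value of the quantizer is one of the values of its regularization. -/
theorem quantizer_mem_filledQuantizer {Δ : ℝ} (hΔ : 0 < Δ) (z : ℝ) :
    quantizer Δ z ∈ filledQuantizer Δ z := by
  refine ⟨?_, le_refl _⟩
  have h : ⌈z / Δ - 1 / 2⌉ ≤ ⌊z / Δ + 1 / 2⌋ := by
    rw [Int.ceil_le]
    linarith [Int.lt_floor_add_one (z / Δ + 1 / 2)]
  have h' : (⌈z / Δ - 1 / 2⌉ : ℝ) ≤ (⌊z / Δ + 1 / 2⌋ : ℝ) := by exact_mod_cast h
  exact mul_le_mul_of_nonneg_right h' hΔ.le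

/-- Off the quantization levels the regularization is single valued. -/
theorem filledQuantizer_of_interior {Δ z : ℝ} (hΔ : 0 < Δ) {j : ℤ}
    (h1 : ((j : ℝ) - 1 / 2) * Δ < z) (h2 : z < ((j : ℝ) + 1 / 2) * Δ) :
    filledQuantizer Δ z = {quantizer Δ z} := by
  have hq := quantizer_eq_of_mem_region hΔ (j := j) ⟨h1.le, h2⟩
  have hc : ⌈z / Δ - 1 / 2⌉ = j := by
    rw [Int.ceil_eq_iff]
    rw [← lt_div_iff₀ hΔ] at h1
    rw [← div_lt_iff₀ hΔ] at h2
    constructor <;> linarith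
  have hq' : (⌊z / Δ + 1 / 2⌋ : ℝ) * Δ = j * Δ := hq
  rw [filledQuantizer, hq', hc, hq, Set.Icc_self]

/-- On a quantization level the regularization is the segment joining the two adjacent values. -/
theorem filledQuantizer_level {Δ : ℝ} (hΔ : 0 < Δ) (j : ℤ) :
    filledQuantizer Δ (((j : ℝ) + 1 / 2) * Δ) = Set.Icc ((j : ℝ) * Δ) (((j : ℝ) + 1) * Δ) := by
  have h0 : ((j : ℝ) + 1 / 2) * Δ / Δ = j + 1 / 2 := by field_simp
  have h1 : (j : ℝ) + 1 / 2 - 1 / 2 = j := by ring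
  have h2 : (j : ℝ) + 1 / 2 + 1 / 2 = ((j + 1 : ℤ) : ℝ) := by push_cast; ring
  rw [filledQuantizer, h0, h1, h2, Int.ceil_intCast, Int.floor_intCast]
  push_cast
  rfl

/-- The reference `δ₀ a₀ + ∑ aᵢ sin (ωᵢ t + θᵢ)`. -/
def reference {m : ℕ} (δ₀ a₀ : ℝ) (a ω θ : Fin m → ℝ) (t : ℝ) : ℝ :=
  δ₀ * a₀ + ∑ i, a i * Real.sin (ω i * t + θ i)

/-- The row `φ(t)`, with the entries `1`, `sin (ωᵢ t)` and `cos (ωᵢ t)`. -/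
def regressor {m : ℕ} (ω : Fin m → ℝ) (t : ℝ) : Unit ⊕ Fin m ⊕ Fin m → ℝ
  | Sum.inl _ => 1
  | Sum.inr (Sum.inl i) => Real.sin (ω i * t)
  | Sum.inr (Sum.inr i) => Real.cos (ω i * t)

/-- The signal `r` crosses a quantization level at time `t`: it passes from one quantization
region to a different one. -/
def CrossesAt (Δ : ℝ) (r : ℝ → ℝ) (t : ℝ) : Prop :=
  ∃ i j : ℤ, i ≠ j ∧ (∀ᶠ s in 𝓝[<] t, r s ∈ region Δ i) ∧ (∀ᶠ s in 𝓝[>] t, r s ∈ region Δ j)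

/-- The crossing times of `r` in `[0, T)`. -/
def crossingTimes (Δ T : ℝ) (r : ℝ → ℝ) : Set ℝ :=
  {t : ℝ | t ∈ Set.Ico 0 T ∧ CrossesAt Δ r t}

/-- The matrix whose rows are `φ(t)`, one for each crossing time `t` of `r` in `[0, T)`. -/
def crossingMatrix {m : ℕ} (Δ T : ℝ) (ω : Fin m → ℝ) (r : ℝ → ℝ) :
    Matrix (crossingTimes Δ T r) (Unit ⊕ Fin m ⊕ Fin m) ℝ :=
  Matrix.of fun t => regressor ω (t : ℝ)

/-- The conditions on the reference `r` of period `T` with frequencies `ωᵢ`: there are at least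
`2 m + 1` crossing times in a period, and the crossing matrix has full column rank `2 m + 1`. -/
structure ReferenceCondition {m : ℕ} (Δ T : ℝ) (ω : Fin m → ℝ) (r : ℝ → ℝ) : Prop where
  period_pos : 0 < T
  periodic : Function.Periodic r T
  card_le : ((2 * m + 1 : ℕ) : ℕ∞) ≤ (crossingTimes Δ T r).encard
  rank_eq : (crossingMatrix Δ T ω r).rank = 2 * m + 1

/-- The order of `s` as a pole of the real rational function `H` (`0` if `s` is not a pole). -/
def poleOrder (H : RatFunc ℝ) (s : ℂ) : ℕ :=
  (H.denom.map (algebraMap ℝ ℂ)).rootMultiplicity s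

/-- `s` is a pole of `H`. -/
def IsPole (H : RatFunc ℝ) (s : ℂ) : Prop := poleOrder H s ≠ 0

/-- `s` is a simple pole of `H`. -/
def IsSimplePole (H : RatFunc ℝ) (s : ℂ) : Prop := poleOrder H s = 1

/-- The real rational function `H` is positive real: it has no pole and nonnegative real part in
the open right half-plane. -/
def PositiveReal (H : RatFunc ℝ) : Prop :=
  ∀ s : ℂ, 0 < s.re → ¬ IsPole H s ∧ 0 ≤ (RatFunc.eval (algebraMap ℝ ℂ) s H).re

/-- The transfer function `C (s I - A)⁻¹ B + D` of a single-input single-output system. -/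
def transferFunction {n : ℕ} (A : Matrix (Fin n) (Fin n) ℝ) (B C : Fin n → ℝ) (D : ℝ) :
    RatFunc ℝ :=
  (fun i => RatFunc.C (C i)) ⬝ᵥ
    ((Matrix.scalar (Fin n) (RatFunc.X : RatFunc ℝ) - A.map (RatFunc.C : ℝ →+* RatFunc ℝ))⁻¹ *ᵥ
      (fun i => RatFunc.C (B i))) + RatFunc.C D

/-- `(A, B, C, D)` is a minimal realization of `H`: it has the transfer function `H`, and no system
with this transfer function has a smaller state dimension. -/
def IsMinimalRealization (H : RatFunc ℝ) {n : ℕ} (A : Matrix (Fin n) (Fin n) ℝ)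
    (B C : Fin n → ℝ) (D : ℝ) : Prop :=
  transferFunction A B C D = H ∧
    ∀ (k : ℕ) (A' : Matrix (Fin k) (Fin k) ℝ) (B' C' : Fin k → ℝ) (D' : ℝ),
      transferFunction A' B' C' D' = H → n ≤ k

/-- `(x, u, y)` is a solution on `[0, ∞)` of the loop in which the linear system `(A, B, C, D)`
with state `x` and output `y` is fed by the error `u = q(r) - q(y)`. The right-hand side is
discontinuous, so solutions are taken in the sense of Filippov: `x` is absolutely continuous and
satisfies the state equation almost everywhere (integral form), and while `y` rests on a
quantization level, where `q` jumps, `q(y)` may be any value between the two one-sided limits.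
Solutions with `u = q(r) - q(y)` throughout are included, see `IsLoopSolution.of_quantizer`. -/
structure IsLoopSolution (Δ : ℝ) (r : ℝ → ℝ) {n : ℕ} (A : Matrix (Fin n) (Fin n) ℝ)
    (B C : Fin n → ℝ) (D : ℝ) (x : ℝ → Fin n → ℝ) (u y : ℝ → ℝ) : Prop where
  continuousOn_state : ContinuousOn x (Set.Ici 0)
  intervalIntegrable_error : ∀ t : ℝ, 0 ≤ t → IntervalIntegrable u volume 0 t
  state_eq : ∀ t : ℝ, 0 ≤ t → x t = x 0 + ∫ s in (0 : ℝ)..t, (A *ᵥ x s + u s • B)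
  output_eq : ∀ t : ℝ, 0 ≤ t → y t = C ⬝ᵥ x t + D * u t
  error_mem : ∀ t : ℝ, 0 ≤ t → ∃ v ∈ filledQuantizer Δ (y t), u t = quantizer Δ (r t) - v

/-- Solutions in the sense of Carathéodory, with `u = q(r) - q(y)`, are loop solutions. -/
theorem IsLoopSolution.of_quantizer {Δ : ℝ} (hΔ : 0 < Δ) {r : ℝ → ℝ} {n : ℕ}
    {A : Matrix (Fin n) (Fin n) ℝ} {B C : Fin n → ℝ} {D : ℝ} {x : ℝ → Fin n → ℝ} {u y : ℝ → ℝ}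
    (hx : ContinuousOn x (Set.Ici 0))
    (hu : ∀ t : ℝ, 0 ≤ t → IntervalIntegrable u volume 0 t)
    (hxeq : ∀ t : ℝ, 0 ≤ t → x t = x 0 + ∫ s in (0 : ℝ)..t, (A *ᵥ x s + u s • B))
    (hy : ∀ t : ℝ, 0 ≤ t → y t = C ⬝ᵥ x t + D * u t)
    (he : ∀ t : ℝ, 0 ≤ t → u t = quantizer Δ (r t) - quantizer Δ (y t)) :
    IsLoopSolution Δ r A B C D x u y :=
  ⟨hx, hu, hxeq, hy, fun t ht => ⟨_, quantizer_mem_filledQuantizer hΔ (y t), he t ht⟩⟩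

end QuantTracking

end

/-! The reference is the output of a free motion `z` of `ẋ = A x`, since the poles of `H` at `0` and
`± j ωᵢ` are eigenvalues of `A` with eigenvectors seen by `C` (`exists_solution_reference`). The
deviation `ξ = z - x` therefore satisfies `ξ' = A ξ - u B`, with tracking error `e = C ξ - D u`.

Energy. Positive realness provides a positive definite quadratic storage `β` (`exists_storage`), and
along solutions `d/dt β(ξ, ξ) ≤ -2 e u`. The quantizer is monotone, so `e u ≥ 0`; hence `ξ` is
bounded and `∫ e u` is finite (`deviation_bounded`). Moreover `e u ≥ dist(r, levels) |u|`, and the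
nonconstant analytic periodic `r` meets the levels only on a null set, so the integral of `|u|` over
the `k`-th period tends to `0` (`tendsto_integral_abs_window`).

Invariance. The motion `ξ` is thus asymptotically free, and a limit point `b` of `ξ(kT)` has an
orbit `exp(sA) b` bounded on the whole line. Only the simple imaginary modes survive, so `C exp(sA)
b` is a combination of `1`, `sin ωᵢ s`, `cos ωᵢ s` (`exists_output_eq_regressor`). If it were
nonzero at a crossing time, then on one side of that time `r` and `y` would be separated by a level,
and `|u|` would stay above a constant on intervals of fixed length, against the decay of its mean
(`output_flow_eq_zero_of_crossing`). The rank condition makes the combination zero and observability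
gives `b = 0`. So `ξ(kT) → 0`, then `ξ → 0`, and `|e| ≤ |C ξ|`.

The storage is built without spectral factorization: it is, up to a factor, the least energy that
steers an implicit midpoint discretization from rest to a given state. Parseval on circles makes
this energy nonnegative (`supply_nonneg`), and the parallelogram law makes it quadratic. -/

namespace QuantTracking

/-! ### Minimal realizations: controllability, observability, poles and eigenvalues -/

section Realization

/-- The matrix `X I - A` over the rational functions. -/
noncomputable abbrev ratCharmatrix {n : ℕ} (A : Matrix (Fin n) (Fin n) ℝ) :
    Matrix (Fin n) (Fin n) (RatFunc ℝ) :=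
  Matrix.scalar (Fin n) (RatFunc.X : RatFunc ℝ) - A.map (RatFunc.C : ℝ →+* RatFunc ℝ)

theorem ratCharmatrix_eq_map {n : ℕ} (A : Matrix (Fin n) (Fin n) ℝ) :
    ratCharmatrix A = A.charmatrix.map (algebraMap (Polynomial ℝ) (RatFunc ℝ)) := by
  ext i j
  by_cases h : i = j
  · subst h
    simp
  · simp [Matrix.charmatrix_apply, Matrix.diagonal_apply_ne _ h]

theorem isUnit_det_ratCharmatrix {n : ℕ} (A : Matrix (Fin n) (Fin n) ℝ) :
    IsUnit (ratCharmatrix A).det := by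
  rw [ratCharmatrix_eq_map, ← RingHom.mapMatrix_apply, ← RingHom.map_det, isUnit_iff_ne_zero]
  intro h
  have h2 : A.charmatrix.det = 0 :=
    (injective_iff_map_eq_zero _).1 (RatFunc.algebraMap_injective ℝ) _ h
  exact (Matrix.charpoly_monic A).ne_zero h2

theorem mulVec_map_ratFuncC {n k : ℕ} (A : Matrix (Fin n) (Fin k) ℝ) (b : Fin k → ℝ) :
    (A.map (RatFunc.C : ℝ →+* RatFunc ℝ)) *ᵥ (fun i => RatFunc.C (b i))
      = fun i => RatFunc.C ((A *ᵥ b) i) := by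
  ext i
  simp [Matrix.mulVec, dotProduct, map_sum]

/-- The intertwining passes to the resolvents: `(X - A)⁻¹ E = E (X - A')⁻¹`. With `E` the inclusion
of an invariant subspace containing `B`, this cuts a realization down to that subspace. -/
theorem transferFunction_eq_of_intertwining {n k : ℕ} {A : Matrix (Fin n) (Fin n) ℝ}
    {A' : Matrix (Fin k) (Fin k) ℝ} {E : Matrix (Fin n) (Fin k) ℝ} {B C : Fin n → ℝ}
    {B' C' : Fin k → ℝ} (D : ℝ) (hA : A * E = E * A') (hB : B = E *ᵥ B') (hC : C' = C ᵥ* E) :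
    transferFunction A B C D = transferFunction A' B' C' D := by
  have hM : ratCharmatrix A * E.map (RatFunc.C : ℝ →+* RatFunc ℝ)
      = E.map (RatFunc.C : ℝ →+* RatFunc ℝ) * ratCharmatrix A' := by
    rw [ratCharmatrix, ratCharmatrix, Matrix.sub_mul, Matrix.mul_sub, ← Matrix.map_mul,
      ← Matrix.map_mul, hA]
    congr 1
    ext i j
    simp [mul_comm]
  have hv : (ratCharmatrix A)⁻¹ *ᵥ (fun i => RatFunc.C (B i)) =
      E.map (RatFunc.C : ℝ →+* RatFunc ℝ) *ᵥ
        ((ratCharmatrix A')⁻¹ *ᵥ (fun i => RatFunc.C (B' i))) := by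
    rw [hB, ← mulVec_map_ratFuncC, Matrix.mulVec_mulVec, Matrix.mulVec_mulVec]
    congr 1
    calc (ratCharmatrix A)⁻¹ * E.map (RatFunc.C : ℝ →+* RatFunc ℝ)
        = (ratCharmatrix A)⁻¹ * (E.map (RatFunc.C : ℝ →+* RatFunc ℝ) * ratCharmatrix A')
            * (ratCharmatrix A')⁻¹ := by
          rw [Matrix.mul_assoc, Matrix.mul_assoc,
            Matrix.mul_nonsing_inv _ (isUnit_det_ratCharmatrix A'), Matrix.mul_one]
      _ = _ := by
          rw [← hM, ← Matrix.mul_assoc, Matrix.nonsing_inv_mul _ (isUnit_det_ratCharmatrix A),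
            Matrix.one_mul]
  have hc : (fun i => RatFunc.C (C' i)) =
      (fun i => RatFunc.C (C i)) ᵥ* E.map (RatFunc.C : ℝ →+* RatFunc ℝ) := by
    ext i
    simp [hC, Matrix.vecMul, dotProduct, map_sum]
  unfold transferFunction
  rw [hv, hc, Matrix.dotProduct_mulVec]

/-- A scalar equals its transpose. This duality turns statements on controllability into statements
on observability. -/
theorem transferFunction_transpose {n : ℕ} (A : Matrix (Fin n) (Fin n) ℝ) (B C : Fin n → ℝ)
    (D : ℝ) : transferFunction Aᵀ C B D = transferFunction A B C D := by
  have h : Matrix.scalar (Fin n) (RatFunc.X : RatFunc ℝ) - Aᵀ.map (RatFunc.C : ℝ →+* RatFunc ℝ)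
      = (Matrix.scalar (Fin n) (RatFunc.X : RatFunc ℝ)
        - A.map (RatFunc.C : ℝ →+* RatFunc ℝ))ᵀ := by
    simp [Matrix.transpose_sub, Matrix.transpose_map]
  unfold transferFunction
  rw [h, ← Matrix.transpose_nonsing_inv, Matrix.mulVec_transpose, dotProduct_comm,
    ← Matrix.dotProduct_mulVec]

namespace IsMinimalRealization

variable {H : RatFunc ℝ} {n : ℕ} {A : Matrix (Fin n) (Fin n) ℝ} {B C : Fin n → ℝ} {D : ℝ}

protected theorem transpose (h : IsMinimalRealization H A B C D) :
    IsMinimalRealization H Aᵀ C B D :=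
  ⟨(transferFunction_transpose A B C D).trans h.1, h.2⟩

/-- A minimal realization is controllable. -/
theorem eq_top_of_invariant (h : IsMinimalRealization H A B C D)
    (W : Submodule ℝ (Fin n → ℝ)) (hW : ∀ v ∈ W, A *ᵥ v ∈ W) (hB : B ∈ W) : W = ⊤ := by
  -- Restricting the system to `W` realizes the same transfer function in dimension `finrank W`, so
  -- minimality leaves no room for a proper subspace.
  let b := Module.finBasis ℝ W
  let E : Matrix (Fin n) (Fin (Module.finrank ℝ W)) ℝ := Matrix.of fun i j => (b j : Fin n → ℝ) i
  have hE : ∀ v : W, E *ᵥ (b.repr v) = v := by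
    intro v
    ext i
    have := congrArg (fun w : W => (w : Fin n → ℝ) i) (b.sum_repr v)
    simp only [Submodule.coe_sum, Submodule.coe_smul, Finset.sum_apply, Pi.smul_apply,
      smul_eq_mul] at this
    rw [← this]
    simp only [E, Matrix.mulVec, dotProduct, Matrix.of_apply, mul_comm]
  let A' : Matrix (Fin (Module.finrank ℝ W)) (Fin (Module.finrank ℝ W)) ℝ :=
    Matrix.of fun i j => b.repr ⟨A *ᵥ (b j : Fin n → ℝ), hW _ (b j).2⟩ i
  have hA : A * E = E * A' := by
    ext i j
    have := congrFun (hE ⟨A *ᵥ (b j : Fin n → ℝ), hW _ (b j).2⟩) i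
    simp only [Matrix.mulVec, dotProduct] at this
    simp only [Matrix.mul_apply, A', Matrix.of_apply]
    rw [this]
    rfl
  have ht := transferFunction_eq_of_intertwining (B := B) (C := C) (B' := b.repr ⟨B, hB⟩)
    (C' := C ᵥ* E) D hA (hE ⟨B, hB⟩).symm rfl
  have hle := h.2 _ _ _ _ _ (ht.symm.trans h.1)
  refine Submodule.eq_top_of_finrank_eq (le_antisymm (Submodule.finrank_le W) ?_)
  simpa using hle

/-- A minimal realization is observable. -/
theorem eq_zero_of_unobservable (h : IsMinimalRealization H A B C D) {v : Fin n → ℝ}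
    (hv : ∀ k : ℕ, C ⬝ᵥ (A ^ k *ᵥ v) = 0) : v = 0 := by
  -- The functionals vanishing on the orbit of `v` form an `Aᵀ`-invariant space containing `C`. By
  -- controllability of the dual system it contains `v` itself, so `v ⬝ᵥ v = 0`.
  let W : Submodule ℝ (Fin n → ℝ) :=
    { carrier := {c | ∀ k : ℕ, c ⬝ᵥ (A ^ k *ᵥ v) = 0}
      add_mem' := fun ha hb k => by rw [add_dotProduct, ha k, hb k, add_zero]
      zero_mem' := fun k => zero_dotProduct _
      smul_mem' := fun c x hx k => by rw [smul_dotProduct, hx k, smul_zero] }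
  have hW : W = ⊤ := by
    refine h.transpose.eq_top_of_invariant W (fun c hc k => ?_) hv
    rw [Matrix.mulVec_transpose, ← Matrix.dotProduct_mulVec, Matrix.mulVec_mulVec, ← pow_succ']
    exact hc (k + 1)
  have : v ∈ W := by rw [hW]; trivial
  have h0 := this 0
  rw [pow_zero, Matrix.one_mulVec] at h0
  exact dotProduct_self_eq_zero.1 h0

/-- The resolvent of a minimal realization has the denominator of the transfer function. -/
theorem exists_resolvent (h : IsMinimalRealization H A B C D) :
    ∃ R : Matrix (Fin n) (Fin n) (Polynomial ℝ),
      R * A.charmatrix = H.denom • (1 : Matrix (Fin n) (Fin n) (Polynomial ℝ)) ∧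
      H.num = (fun i => Polynomial.C (C i)) ⬝ᵥ (R *ᵥ fun i => Polynomial.C (B i))
        + Polynomial.C D * H.denom := by
  set ι := algebraMap (Polynomial ℝ) (RatFunc ℝ) with hι
  have hinj : Function.Injective ι := RatFunc.algebraMap_injective ℝ
  set d : RatFunc ℝ := ι H.denom with hd
  set N := (ratCharmatrix A)⁻¹ with hN
  have hNM : N * ratCharmatrix A = 1 := Matrix.nonsing_inv_mul _ (isUnit_det_ratCharmatrix A)
  have hMN : ratCharmatrix A * N = 1 := Matrix.mul_nonsing_inv _ (isUnit_det_ratCharmatrix A)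
  have hNA : N * A.map (RatFunc.C : ℝ →+* RatFunc ℝ) = (RatFunc.X : RatFunc ℝ) • N - 1 := by
    rw [← hNM, ratCharmatrix, Matrix.mul_sub]
    ext i j
    simp [mul_comm]
  have hAN : A.map (RatFunc.C : ℝ →+* RatFunc ℝ) * N = (RatFunc.X : RatFunc ℝ) • N - 1 := by
    rw [← hMN, ratCharmatrix, Matrix.sub_mul]
    ext i j
    simp
  have hdH : ι H.num = d * H := by
    have := RatFunc.num_div_denom H
    rw [div_eq_iff (by simpa using H.denom_ne_zero)] at this
    rw [this, mul_comm]
  have hHN : H = (fun i => RatFunc.C (C i)) ⬝ᵥ (N *ᵥ fun i => RatFunc.C (B i)) + RatFunc.C D :=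
    h.1.symm
  let S : Subring (RatFunc ℝ) := ι.range
  have hCS : ∀ a : ℝ, RatFunc.C a ∈ S := fun a => ⟨Polynomial.C a, by simp [hι]⟩
  have hXS : RatFunc.X ∈ S := ⟨Polynomial.X, by simp [hι]⟩
  have hdS : d ∈ S := ⟨_, rfl⟩
  have hdotS : ∀ c b : Fin n → ℝ,
      (fun i => (RatFunc.C (c i) : RatFunc ℝ)) ⬝ᵥ (fun i => RatFunc.C (b i)) ∈ S := fun c b =>
    S.sum_mem fun i _ => S.mul_mem (hCS _) (hCS _)
  let G : (Fin n → ℝ) → (Fin n → ℝ) → RatFunc ℝ := fun c b =>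
    d * ((fun i => RatFunc.C (c i)) ⬝ᵥ (N *ᵥ fun i => RatFunc.C (b i)))
  have Gadd : ∀ c b b', G c (b + b') = G c b + G c b' := by
    intro c b b'
    have : (fun i => (RatFunc.C ((b + b') i) : RatFunc ℝ))
        = (fun i => RatFunc.C (b i)) + fun i => RatFunc.C (b' i) := by ext i; simp
    simp only [G, this, Matrix.mulVec_add, dotProduct_add, mul_add]
  have Gsmul : ∀ c (a : ℝ) b, G c (a • b) = RatFunc.C a * G c b := by
    intro c a b
    have : (fun i => (RatFunc.C ((a • b) i) : RatFunc ℝ))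
        = (RatFunc.C a : RatFunc ℝ) • fun i => RatFunc.C (b i) := by ext i; simp
    simp only [G, this, Matrix.mulVec_smul, dotProduct_smul, smul_eq_mul]
    ring
  have Gadd' : ∀ c c' b, G (c + c') b = G c b + G c' b := by
    intro c c' b
    have : (fun i => (RatFunc.C ((c + c') i) : RatFunc ℝ))
        = (fun i => RatFunc.C (c i)) + fun i => RatFunc.C (c' i) := by ext i; simp
    simp only [G, this, add_dotProduct, mul_add]
  have Gsmul' : ∀ c (a : ℝ) b, G (a • c) b = RatFunc.C a * G c b := by
    intro c a b
    have : (fun i => (RatFunc.C ((a • c) i) : RatFunc ℝ))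
        = (RatFunc.C a : RatFunc ℝ) • fun i => RatFunc.C (c i) := by ext i; simp
    simp only [G, this, smul_dotProduct, smul_eq_mul]
    ring
  -- `G c b` is the denominator times `cᵀ (X - A)⁻¹ b`, and `S` is the ring of polynomials. As `N A
  -- = X N - 1`, polynomiality of `G C b` is inherited by `A *ᵥ b`, and it holds for `b = B` because
  -- `d H` is the numerator. Controllability extends it to all `b`; the dual argument then frees
  -- `c`.
  let W : Submodule ℝ (Fin n → ℝ) :=
    { carrier := {b | G C b ∈ S}
      add_mem' := fun ha hb => by
        simp only [Set.mem_ofPred_eq, Gadd] at *; exact S.add_mem ha hb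
      zero_mem' := by
        have := Gsmul C 0 0
        simp only [zero_smul, map_zero, zero_mul] at this
        simp only [Set.mem_ofPred_eq, this]; exact S.zero_mem
      smul_mem' := fun a b hb => by
        simp only [Set.mem_ofPred_eq, Gsmul] at *; exact S.mul_mem (hCS a) hb }
  have hW : W = ⊤ := by
    refine h.eq_top_of_invariant W (fun b hb => ?_) ?_
    · change G C (A *ᵥ b) ∈ S
      have : G C (A *ᵥ b) = RatFunc.X * G C b
          - d * ((fun i => RatFunc.C (C i)) ⬝ᵥ (fun i => RatFunc.C (b i))) := by
        simp only [G]
        rw [← mulVec_map_ratFuncC, Matrix.mulVec_mulVec, hNA, Matrix.sub_mulVec,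
          Matrix.smul_mulVec, Matrix.one_mulVec, dotProduct_sub, dotProduct_smul, smul_eq_mul]
        ring
      rw [this]
      exact S.sub_mem (S.mul_mem hXS hb) (S.mul_mem hdS (hdotS _ _))
    · change G C B ∈ S
      have : G C B = ι H.num - d * RatFunc.C D := by
        rw [hdH]
        conv_rhs => rw [hHN]
        simp only [G]
        ring
      rw [this]
      exact S.sub_mem ⟨_, rfl⟩ (S.mul_mem hdS (hCS _))
  let W' : Submodule ℝ (Fin n → ℝ) :=
    { carrier := {c | ∀ b, G c b ∈ S}
      add_mem' := fun ha hb b => by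
        rw [Gadd']; exact S.add_mem (ha b) (hb b)
      zero_mem' := fun b => by
        have := Gsmul' 0 0 b
        simp only [zero_smul, map_zero, zero_mul] at this
        rw [this]; exact S.zero_mem
      smul_mem' := fun a c hc b => by
        rw [Gsmul']; exact S.mul_mem (hCS a) (hc b) }
  have hW' : W' = ⊤ := by
    refine h.transpose.eq_top_of_invariant W' (fun c hc b => ?_) (fun b => ?_)
    · have : G (Aᵀ *ᵥ c) b = RatFunc.X * G c b
          - d * ((fun i => RatFunc.C (c i)) ⬝ᵥ (fun i => RatFunc.C (b i))) := by
        simp only [G]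
        rw [← mulVec_map_ratFuncC, Matrix.transpose_map, Matrix.mulVec_transpose,
          ← Matrix.dotProduct_mulVec, Matrix.mulVec_mulVec, hAN, Matrix.sub_mulVec,
          Matrix.smul_mulVec, Matrix.one_mulVec, dotProduct_sub, dotProduct_smul, smul_eq_mul]
        ring
      rw [this]
      exact S.sub_mem (S.mul_mem hXS (hc b)) (S.mul_mem hdS (hdotS _ _))
    · have : b ∈ W := by rw [hW]; trivial
      exact this
  have hent : ∀ i j, ∃ p : Polynomial ℝ, ι p = d * N i j := by
    intro i j
    have h1 : (Pi.single i 1 : Fin n → ℝ) ∈ W' := by rw [hW']; trivial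
    have h2 := h1 (Pi.single j 1)
    have e1 : ∀ k : Fin n, (fun i => (RatFunc.C ((Pi.single k 1 : Fin n → ℝ) i) : RatFunc ℝ))
        = Pi.single k 1 := by
      intro k
      ext l
      by_cases hl : l = k
      · subst hl; simp
      · simp [Pi.single_eq_of_ne hl]
    simp only [G, e1, Matrix.mulVec_single_one, single_one_dotProduct, Matrix.col_apply] at h2
    exact h2
  choose R hR using hent
  refine ⟨Matrix.of R, ?_, ?_⟩
  · have hmap : (Matrix.of R).map ι = d • N := by
      ext i j
      simp [hR]
    have : (Matrix.of R * A.charmatrix).map ι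
        = (H.denom • (1 : Matrix (Fin n) (Fin n) (Polynomial ℝ))).map ι := by
      rw [Matrix.map_mul, hmap, ← ratCharmatrix_eq_map, Matrix.smul_mul, hNM]
      ext i j
      by_cases hij : i = j
      · subst hij; simp [hd]
      · simp [Matrix.one_apply_ne hij]
    exact Matrix.map_injective hinj this
  · apply hinj
    rw [hdH]
    conv_lhs => rw [hHN]
    simp only [Matrix.mulVec, dotProduct, map_add, map_sum, map_mul, Matrix.of_apply, hR]
    simp only [hι, RatFunc.algebraMap_C, mul_add, Finset.mul_sum]
    congr 1
    · refine Finset.sum_congr rfl fun i _ => Finset.sum_congr rfl fun j _ => ?_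
      ring
    · ring

/-- The denominator of the transfer function annihilates the state matrix. -/
theorem aeval_denom_eq_zero (h : IsMinimalRealization H A B C D) :
    Polynomial.aeval A H.denom = 0 := by
  obtain ⟨R, hR, -⟩ := h.exists_resolvent
  -- As in the Cayley–Hamilton theorem: in the ring of polynomials with matrix coefficients the
  -- factor `X - A` stands on the right, so evaluation at `A` annihilates the product.
  apply_fun matPolyEquiv at hR
  simp only [map_mul, Matrix.matPolyEquiv_charmatrix] at hR
  apply_fun fun p => p.eval A at hR
  rw [Polynomial.eval_mul_X_sub_C, matPolyEquiv_smul_one, Polynomial.eval_map] at hR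
  exact hR.symm

/-- Clearing the denominator keeps the resolvent identity meaningful at the poles, where `s - A` is
not invertible. -/
theorem exists_complex_resolvent (h : IsMinimalRealization H A B C D) :
    ∃ R : Matrix (Fin n) (Fin n) (Polynomial ℝ), ∀ s : ℂ,
      (∀ z : Fin n → ℂ, R.map (Polynomial.eval₂RingHom (algebraMap ℝ ℂ) s) *ᵥ
          (s • z - A.map (algebraMap ℝ ℂ) *ᵥ z) = (H.denom.eval₂ (algebraMap ℝ ℂ) s) • z) ∧
      H.num.eval₂ (algebraMap ℝ ℂ) s = (fun i => (C i : ℂ)) ⬝ᵥ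
          (R.map (Polynomial.eval₂RingHom (algebraMap ℝ ℂ) s) *ᵥ fun i => (B i : ℂ))
        + D * H.denom.eval₂ (algebraMap ℝ ℂ) s := by
  obtain ⟨R, hR, hnum⟩ := h.exists_resolvent
  refine ⟨R, fun s => ?_⟩
  set ev := Polynomial.eval₂RingHom (algebraMap ℝ ℂ) s with hev
  refine ⟨fun z => ?_, ?_⟩
  · have h1 : A.charmatrix.map ev *ᵥ z = s • z - A.map (algebraMap ℝ ℂ) *ᵥ z := by
      have : A.charmatrix.map ev = s • (1 : Matrix (Fin n) (Fin n) ℂ) - A.map (algebraMap ℝ ℂ) := by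
        ext i j
        by_cases hij : i = j
        · subst hij; simp [hev]
        · simp [hev, Matrix.charmatrix_apply_ne _ _ _ hij, Matrix.one_apply_ne hij]
      rw [this, Matrix.sub_mulVec, Matrix.smul_mulVec, Matrix.one_mulVec]
    rw [← h1, Matrix.mulVec_mulVec, ← Matrix.map_mul, hR]
    have : (H.denom • (1 : Matrix (Fin n) (Fin n) (Polynomial ℝ))).map ev
        = (ev H.denom) • (1 : Matrix (Fin n) (Fin n) ℂ) := by
      ext i j
      by_cases hij : i = j
      · subst hij; simp
      · simp [Matrix.one_apply_ne hij]
    rw [this, Matrix.smul_mulVec, Matrix.one_mulVec]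
    rfl
  · change ev H.num = _ + D * ev H.denom
    conv_lhs => rw [hnum]
    simp only [Matrix.mulVec, dotProduct, map_add, map_sum, map_mul, Matrix.map_apply]
    simp [hev]

/-- The output for an exponential input and an exponential forcing of the state. -/
theorem exists_polynomial_output (h : IsMinimalRealization H A B C D) (ξ : Fin n → ℝ) :
    ∃ q : Polynomial ℝ, ∀ (s : ℂ) (z : Fin n → ℂ) (a b : ℂ),
      H.denom.eval₂ (algebraMap ℝ ℂ) s ≠ 0 →
      s • z - A.map (algebraMap ℝ ℂ) *ᵥ z = b • (fun i => (B i : ℂ)) + a • (fun i => (ξ i : ℂ)) →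
      (fun i => (C i : ℂ)) ⬝ᵥ z + D * b = RatFunc.eval (algebraMap ℝ ℂ) s H * b
        + a * (q.eval₂ (algebraMap ℝ ℂ) s / H.denom.eval₂ (algebraMap ℝ ℂ) s) := by
  obtain ⟨R, hR⟩ := h.exists_complex_resolvent
  refine ⟨(fun i => Polynomial.C (C i)) ⬝ᵥ (R *ᵥ fun i => Polynomial.C (ξ i)),
    fun s z a b hs hz => ?_⟩
  obtain ⟨hR, hnum⟩ := hR s
  have h1 := hR z
  rw [hz, Matrix.mulVec_add, Matrix.mulVec_smul, Matrix.mulVec_smul] at h1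
  set ev := Polynomial.eval₂RingHom (algebraMap ℝ ℂ) s with hev
  have h3 : Polynomial.eval₂ (algebraMap ℝ ℂ) s
      ((fun i => Polynomial.C (C i)) ⬝ᵥ (R *ᵥ fun i => Polynomial.C (ξ i)))
      = (fun i => (C i : ℂ)) ⬝ᵥ (R.map ev *ᵥ fun i => (ξ i : ℂ)) := by
    change ev _ = _
    simp only [Matrix.mulVec, dotProduct, map_sum, map_mul, Matrix.map_apply]
    simp [hev]
  have h2 := congrArg (fun w => (fun i => (C i : ℂ)) ⬝ᵥ w) h1
  simp only [dotProduct_add, dotProduct_smul, smul_eq_mul] at h2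
  rw [RatFunc.eval, hnum, h3]
  field_simp
  linear_combination -h2

theorem denom_eval_eq_zero_of_eigenvector (h : IsMinimalRealization H A B C D) {s : ℂ}
    {w : Fin n → ℂ} (hw : w ≠ 0) (hsw : A.map (algebraMap ℝ ℂ) *ᵥ w = s • w) :
    H.denom.eval₂ (algebraMap ℝ ℂ) s = 0 := by
  obtain ⟨R, hR⟩ := h.exists_complex_resolvent
  replace hR := (hR s).1
  have := hR w
  rw [hsw, sub_self, Matrix.mulVec_zero] at this
  exact (smul_eq_zero.1 this.symm).resolve_right hw

/-- Poles of the transfer function are eigenvalues with an observable eigenvector. -/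
theorem exists_eigenvector (h : IsMinimalRealization H A B C D) {s : ℂ}
    (hs : H.denom.eval₂ (algebraMap ℝ ℂ) s = 0) :
    ∃ w : Fin n → ℂ, A.map (algebraMap ℝ ℂ) *ᵥ w = s • w ∧ (fun i => (C i : ℂ)) ⬝ᵥ w ≠ 0 := by
  obtain ⟨R, hR⟩ := h.exists_complex_resolvent
  obtain ⟨hR, hnum⟩ := hR s
  have hex : ∃ w : Fin n → ℂ, w ≠ 0 ∧ (s • 1 - A.map (algebraMap ℝ ℂ)) *ᵥ w = 0 := by
    rw [Matrix.exists_mulVec_eq_zero_iff]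
    -- If `s - A` were invertible, `R(s) (s - A) = d(s) = 0` would give `R(s) = 0`, so numerator and
    -- denominator would share the root `s`, against coprimality.
    by_contra hdet
    have hu : IsUnit (s • 1 - A.map (algebraMap ℝ ℂ)).det := isUnit_iff_ne_zero.2 hdet
    have hR0 : ∀ v : Fin n → ℂ,
        R.map (Polynomial.eval₂RingHom (algebraMap ℝ ℂ) s) *ᵥ v = 0 := by
      intro v
      have := hR ((s • 1 - A.map (algebraMap ℝ ℂ))⁻¹ *ᵥ v)
      rw [hs, zero_smul] at this
      rw [← this]
      congr 1
      have h2 : (s • 1 - A.map (algebraMap ℝ ℂ)) *ᵥ ((s • 1 - A.map (algebraMap ℝ ℂ))⁻¹ *ᵥ v)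
          = v := by
        rw [Matrix.mulVec_mulVec, Matrix.mul_nonsing_inv _ hu, Matrix.one_mulVec]
      conv_lhs => rw [← h2]
      rw [Matrix.sub_mulVec, Matrix.smul_mulVec, Matrix.one_mulVec]
    rw [hR0, dotProduct_zero, hs, mul_zero, add_zero] at hnum
    obtain ⟨p, q, hpq⟩ := RatFunc.isCoprime_num_denom H
    have := congrArg (Polynomial.eval₂ (algebraMap ℝ ℂ) s) hpq
    simp only [Polynomial.eval₂_add, Polynomial.eval₂_mul, hnum, hs] at this
    simp at this
  obtain ⟨w, hw0, hw⟩ := hex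
  rw [Matrix.sub_mulVec, Matrix.smul_mulVec, Matrix.one_mulVec, sub_eq_zero] at hw
  refine ⟨w, hw.symm, fun hC => hw0 ?_⟩
  have hpow : ∀ k : ℕ, (fun i => (C i : ℂ)) ⬝ᵥ ((A.map (algebraMap ℝ ℂ)) ^ k *ᵥ w) = 0 := by
    intro k
    have : (A.map (algebraMap ℝ ℂ)) ^ k *ᵥ w = s ^ k • w := by
      induction k with
      | zero => simp
      | succ k ih =>
        rw [pow_succ', ← Matrix.mulVec_mulVec, ih, Matrix.mulVec_smul, ← hw, smul_smul, pow_succ]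
    rw [this, dotProduct_smul, hC, smul_zero]
  have hmap : ∀ k : ℕ, (A.map (algebraMap ℝ ℂ)) ^ k = (A ^ k).map (algebraMap ℝ ℂ) := by
    intro k
    exact ((algebraMap ℝ ℂ).mapMatrix.map_pow A k).symm
  -- The system is real, so the real and imaginary parts of an unobservable complex vector are
  -- unobservable real vectors.
  have hre : (fun i => (w i).re) = 0 := h.eq_zero_of_unobservable fun k => by
    have := congrArg Complex.re (hpow k)
    rw [hmap] at this
    simpa [dotProduct, Matrix.mulVec] using this
  have him : (fun i => (w i).im) = 0 := h.eq_zero_of_unobservable fun k => by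
    have := congrArg Complex.im (hpow k)
    rw [hmap] at this
    simpa [dotProduct, Matrix.mulVec] using this
  ext i
  exact Complex.ext (congrFun hre i) (congrFun him i)

end IsMinimalRealization

theorem isPole_iff {H : RatFunc ℝ} {s : ℂ} :
    IsPole H s ↔ H.denom.eval₂ (algebraMap ℝ ℂ) s = 0 := by
  have h0 : H.denom.map (algebraMap ℝ ℂ) ≠ 0 :=
    (Polynomial.map_ne_zero_iff (algebraMap ℝ ℂ).injective).2 H.denom_ne_zero
  rw [IsPole, poleOrder, ← Nat.pos_iff_ne_zero, Polynomial.rootMultiplicity_pos h0,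
    Polynomial.IsRoot, Polynomial.eval_map]

end Realization

/-! ### A Parseval inequality on circles in the unit disc -/

section Circle

open ComplexConjugate

/-- On the circle `conj v * v = ρ ^ 2`, so the integrand agrees there with an analytic function and
the mean value property applies. -/
theorem circleAverage_conj_pow_mul {ρ : ℝ} (hρ : 0 < ρ) {f : ℂ → ℂ}
    (hf : DiffContOnCl ℂ f (Metric.ball 0 |ρ|)) {a b : ℕ} (hab : a ≤ b) :
    Real.circleAverage (fun v => conj v ^ a * (v ^ b * f v)) 0 ρ
      = (ρ : ℂ) ^ (2 * a) * (0 ^ (b - a) * f 0) := by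
  have hd : DiffContOnCl ℂ (fun v : ℂ => (ρ : ℂ) ^ (2 * a) * (v ^ (b - a) * f v))
      (Metric.ball 0 |ρ|) := by
    have : DiffContOnCl ℂ (fun v : ℂ => v ^ (b - a)) (Metric.ball 0 |ρ|) :=
      (differentiable_pow _).diffContOnCl
    exact (this.smul hf).const_smul ((ρ : ℂ) ^ (2 * a))
  rw [← hd.circleAverage]
  refine Real.circleAverage_congr_sphere fun v hv => ?_
  have hv' : ‖v‖ = ρ := by simpa [abs_of_pos hρ] using hv
  have h1 : conj v * v = (ρ : ℂ) ^ 2 := by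
    rw [mul_comm, Complex.mul_conj, Complex.normSq_eq_norm_sq, hv']
    push_cast
    rfl
  obtain ⟨c, rfl⟩ := Nat.exists_eq_add_of_le hab
  simp only [add_tsub_cancel_left]
  rw [pow_mul, ← h1]
  ring

theorem circleAverage_conj_pow_mul_pow {ρ : ℝ} (hρ : 0 < ρ) (a b : ℕ) :
    Real.circleAverage (fun v : ℂ => conj v ^ a * v ^ b) 0 ρ
      = if a = b then (ρ : ℂ) ^ (2 * a) else 0 := by
  have key : ∀ a b : ℕ, a ≤ b → Real.circleAverage (fun v : ℂ => conj v ^ a * v ^ b) 0 ρ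
      = if a = b then (ρ : ℂ) ^ (2 * a) else 0 := by
    intro a b hab
    have := circleAverage_conj_pow_mul (f := fun _ => 1) hρ diffContOnCl_const hab
    simp only [mul_one] at this
    rw [this]
    split_ifs with h
    · simp [h]
    · have : b - a ≠ 0 := by omega
      simp [this]
  rcases le_total a b with h | h
  · exact key a b h
  · have h1 := key b a h
    have h2 := Complex.conjCLE.toContinuousLinearMap.circleAverage_comp_comm (c := 0) (R := ρ)
      (f := fun v : ℂ => conj v ^ b * v ^ a) (by
        apply ContinuousOn.circleIntegrable hρ.le
        fun_prop)
    have h3 : (Complex.conjCLE.toContinuousLinearMap ∘ fun v : ℂ => conj v ^ b * v ^ a)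
        = fun v : ℂ => conj v ^ a * v ^ b := by
      ext v
      simp [mul_comm]
    rw [h3, h1] at h2
    rw [h2]
    split_ifs with h4 h5 h5
    · simp [h4]
    · omega
    · omega
    · simp

/-- Averaging over `‖v‖ = ρ` leaves only the diagonal terms `ρ ^ (2 (N - k)) u k y k`, by
orthogonality of the powers. The tail `v ^ (N + 1) * h v` contributes nothing, since its order at
`0` exceeds every power paired with it. Then `ρ → 1`. -/
theorem sum_mul_nonneg_of_circle (N : ℕ) (u y : ℕ → ℝ) (h : ℂ → ℂ)
    (hh : DifferentiableOn ℂ h (Metric.ball 0 1))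
    (hre : ∀ v : ℂ, ‖v‖ < 1 →
      0 ≤ (conj (∑ k ∈ Finset.range N, v ^ (N - k) * (u k : ℂ)) *
        (∑ k ∈ Finset.range N, v ^ (N - k) * (y k : ℂ) + v ^ (N + 1) * h v)).re) :
    0 ≤ ∑ k ∈ Finset.range N, u k * y k := by
  have key : ∀ ρ : ℝ, 0 < ρ → ρ < 1 →
      0 ≤ ∑ k ∈ Finset.range N, ρ ^ (2 * (N - k)) * (u k * y k) := by
    intro ρ hρ hρ1
    have habs : |ρ| = ρ := abs_of_pos hρ
    have hsub : Metric.closedBall (0 : ℂ) ρ ⊆ Metric.ball 0 1 := Metric.closedBall_subset_ball hρ1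
    have hdc : DiffContOnCl ℂ h (Metric.ball 0 |ρ|) := by
      rw [habs]
      exact (hh.mono (closure_ball (0 : ℂ) hρ.ne' ▸ hsub)).diffContOnCl
    have hci : ∀ a b : ℕ, ∀ c : ℂ,
        CircleIntegrable (fun v => c * (conj v ^ a * (v ^ b * h v))) 0 ρ := by
      intro a b c
      apply ContinuousOn.circleIntegrable hρ.le
      have : ContinuousOn h (Metric.sphere 0 ρ) :=
        hh.continuousOn.mono (Metric.sphere_subset_closedBall.trans hsub)
      fun_prop
    have hci' : ∀ a b : ℕ, ∀ c : ℂ,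
        CircleIntegrable (fun v => c * (conj v ^ a * v ^ b)) 0 ρ := by
      intro a b c
      apply ContinuousOn.circleIntegrable hρ.le
      fun_prop
    have hci2 : ∀ k : ℕ, CircleIntegrable (fun v => (∑ l ∈ Finset.range N,
        ((u k * y l : ℝ) : ℂ) * (conj v ^ (N - k) * v ^ (N - l)))) 0 ρ := fun k =>
      CircleIntegrable.fun_sum _ fun l _ => hci' _ _ _
    have hci3 : ∀ k : ℕ, CircleIntegrable (fun v => (∑ l ∈ Finset.range N,
        ((u k * y l : ℝ) : ℂ) * (conj v ^ (N - k) * v ^ (N - l)))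
          + (u k : ℂ) * (conj v ^ (N - k) * (v ^ (N + 1) * h v))) 0 ρ := fun k =>
      (hci2 k).add (hci _ _ _)
    have hexp : ∀ v : ℂ, conj (∑ k ∈ Finset.range N, v ^ (N - k) * (u k : ℂ)) *
        (∑ k ∈ Finset.range N, v ^ (N - k) * (y k : ℂ) + v ^ (N + 1) * h v)
        = ∑ k ∈ Finset.range N, ((∑ l ∈ Finset.range N,
            ((u k * y l : ℝ) : ℂ) * (conj v ^ (N - k) * v ^ (N - l)))
          + (u k : ℂ) * (conj v ^ (N - k) * (v ^ (N + 1) * h v))) := by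
      intro v
      rw [map_sum, Finset.sum_mul]
      refine Finset.sum_congr rfl fun k _ => ?_
      rw [mul_add, Finset.mul_sum]
      simp only [map_mul, map_pow, Complex.conj_ofReal]
      congr 1
      · refine Finset.sum_congr rfl fun l _ => ?_
        push_cast
        ring
      · ring
    have havg : Real.circleAverage (fun v : ℂ =>
        conj (∑ k ∈ Finset.range N, v ^ (N - k) * (u k : ℂ)) *
        (∑ k ∈ Finset.range N, v ^ (N - k) * (y k : ℂ) + v ^ (N + 1) * h v)) 0 ρ
        = ((∑ k ∈ Finset.range N, ρ ^ (2 * (N - k)) * (u k * y k) : ℝ) : ℂ) := by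
      simp only [hexp]
      rw [Real.circleAverage_fun_sum fun k _ => hci3 k]
      rw [Complex.ofReal_sum]
      refine Finset.sum_congr rfl fun k hk => ?_
      have hk' := Finset.mem_range.1 hk
      rw [Real.circleAverage_fun_add (hci2 k) (hci _ _ _), Real.circleAverage_fun_sum fun l _ => hci' _ _ _]
      simp only [← smul_eq_mul (a := ((_ : ℝ) : ℂ)), Real.circleAverage_fun_smul]
      simp only [smul_eq_mul]
      rw [circleAverage_conj_pow_mul hρ hdc (by omega)]
      simp only [circleAverage_conj_pow_mul_pow hρ]
      rw [Finset.sum_eq_single k]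
      · have : N + 1 - (N - k) ≠ 0 := by omega
        simp only [this, ne_eq, not_false_eq_true, zero_pow, zero_mul, mul_zero, add_zero, if_true]
        push_cast
        ring
      · intro l hl hlk
        have hl' := Finset.mem_range.1 hl
        have : N - k ≠ N - l := by omega
        simp [this]
      · exact fun hk2 => absurd hk hk2
    have hnn := Real.circleAverage_nonneg_of_nonneg (c := 0) (R := ρ) (f := fun v : ℂ =>
        (conj (∑ k ∈ Finset.range N, v ^ (N - k) * (u k : ℂ)) *
        (∑ k ∈ Finset.range N, v ^ (N - k) * (y k : ℂ) + v ^ (N + 1) * h v)).re) (fun v hv =>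
        hre v (by
          have : ‖v‖ = ρ := by simpa [habs] using hv
          rw [this]; exact hρ1))
    have hcomm := Complex.reCLM.circleAverage_comp_comm (c := 0) (R := ρ) (f := fun v : ℂ =>
        (conj (∑ k ∈ Finset.range N, v ^ (N - k) * (u k : ℂ)) *
        (∑ k ∈ Finset.range N, v ^ (N - k) * (y k : ℂ) + v ^ (N + 1) * h v))) (by
          have : ContinuousOn h (Metric.sphere 0 |ρ|) := by
            rw [habs]
            exact hh.continuousOn.mono (Metric.sphere_subset_closedBall.trans hsub)
          fun_prop)
    rw [havg] at hcomm
    change Real.circleAverage (fun v : ℂ => _) 0 ρ = _ at hcomm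
    simp only [Function.comp_def, Complex.reCLM_apply, Complex.ofReal_re] at hcomm
    rw [hcomm] at hnn
    exact hnn
  have hcont : Continuous fun ρ : ℝ =>
      ∑ k ∈ Finset.range N, ρ ^ (2 * (N - k)) * (u k * y k) := by fun_prop
  have hlim : Tendsto (fun ρ : ℝ => ∑ k ∈ Finset.range N, ρ ^ (2 * (N - k)) * (u k * y k))
      (𝓝[<] 1) (𝓝 (∑ k ∈ Finset.range N, u k * y k)) := by
    have := (hcont.tendsto 1).mono_left (nhdsWithin_le_nhds (s := Set.Iio 1))
    simpa using this
  refine ge_of_tendsto hlim ?_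
  filter_upwards [Ioo_mem_nhdsLT (zero_lt_one (α := ℝ))] with ρ hρ
  exact key ρ hρ.1 hρ.2

end Circle

/-! ### Quadratic forms from the parallelogram law -/

section Parallelogram

/-- Vanishing at `1` makes `g` invariant under integer shifts, so the bound on `[0, 1]` holds on the
whole line; and `n |g c| = |g (n c)|` is bounded in `n` only if `g c = 0`. -/
theorem AddMonoidHom.eq_zero_of_bounded (g : ℝ →+ ℝ) (h1 : g 1 = 0) {M : ℝ}
    (hM : ∀ c : ℝ, 0 ≤ c → c ≤ 1 → |g c| ≤ M) (c : ℝ) : g c = 0 := by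
  have hn : ∀ n : ℕ, n * |g c| ≤ M := by
    intro n
    have e1 : g (n * c) = n * g c := by
      rw [← nsmul_eq_mul, map_nsmul, nsmul_eq_mul]
    have e2 : g (⌊(n : ℝ) * c⌋ : ℝ) = 0 := by
      rw [← zsmul_one, map_zsmul, h1, smul_zero]
    have e3 : g (n * c) = g (Int.fract ((n : ℝ) * c)) := by
      conv_lhs => rw [← Int.floor_add_fract ((n : ℝ) * c)]
      rw [map_add, e2, zero_add]
    have := hM _ (Int.fract_nonneg ((n : ℝ) * c)) (Int.fract_lt_one _).le
    rwa [← e3, e1, abs_mul, Nat.abs_cast] at this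
  by_contra hne
  have hpos : 0 < |g c| := abs_pos.2 hne
  obtain ⟨n, hn'⟩ := exists_nat_gt (M / |g c|)
  rw [div_lt_iff₀ hpos] at hn'
  exact absurd (hn n) (not_le.2 hn')

/-- A nonnegative homogeneous function satisfying the parallelogram law is a quadratic form. -/
theorem exists_bilinForm_of_parallelogram {V : Type*} [AddCommGroup V] [Module ℝ V] (F : V → ℝ)
    (h0 : ∀ x, 0 ≤ F x) (hp : ∀ x y, F (x + y) + F (x - y) = 2 * F x + 2 * F y)
    (hs : ∀ (c : ℝ) x, F (c • x) = c ^ 2 * F x) :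
    ∃ β : LinearMap.BilinForm ℝ V, (∀ x y, β x y = β y x) ∧ ∀ x, β x x = F x := by
  have hneg : ∀ x, F (-x) = F x := fun x => by
    have := hs (-1) x
    simpa using this
  have hzero : F 0 = 0 := by simpa using hs 0 0
  let G : V → V → ℝ := fun x y => (F (x + y) - F (x - y)) / 4
  have hadd : ∀ x y z, G x (y + z) = G x y + G x z := by
    intro x y z
    have e1 := hp (x + y) z
    have e2 := hp (x + z) y
    have e3 := hp (x - y) z
    have e4 := hp (x - z) y
    have a1 : x + y + z = x + (y + z) := by abel
    have a2 : x + z + y = x + (y + z) := by abel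
    have a3 : x + z - y = x - y + z := by abel
    have a4 : x - y - z = x - (y + z) := by abel
    have a5 : x - z - y = x - (y + z) := by abel
    have a6 : x - z + y = x + y - z := by abel
    rw [a1] at e1
    rw [a2, a3] at e2
    rw [a4] at e3
    rw [a5, a6] at e4
    simp only [G]
    linarith
  have hsymm : ∀ x y, G x y = G y x := by
    intro x y
    simp only [G]
    rw [add_comm y x, ← hneg (y - x), neg_sub]
  have hb : ∀ x y, |G x y| ≤ F x + F y := by
    intro x y
    have e := hp x y
    have p1 := h0 (x + y)
    have p2 := h0 (x - y)
    simp only [G]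
    rw [abs_le]
    constructor <;> linarith [h0 x, h0 y]
  have hsmul : ∀ (c : ℝ) x y, G x (c • y) = c * G x y := by
    intro c x y
    -- The defect of homogeneity is additive in the scalar, vanishes at `1` and is bounded on `[0,
    -- 1]`. Nonnegativity of `F` replaces a continuity assumption here.
    let g : ℝ →+ ℝ :=
      { toFun := fun c => G x (c • y) - c * G x y
        map_zero' := by simp [G]
        map_add' := fun a b => by rw [add_smul, hadd]; ring }
    have := AddMonoidHom.eq_zero_of_bounded g (by simp [g]) (M := F x + F y + |G x y|)
      (fun c hc0 hc1 => by
        change |G x (c • y) - c * G x y| ≤ _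
        have e1 := hb x (c • y)
        rw [hs] at e1
        have e2 : c ^ 2 * F y ≤ F y := by
          exact mul_le_of_le_one_left (h0 y) (pow_le_one₀ hc0 hc1)
        have e3 : |c * G x y| ≤ |G x y| := by
          rw [abs_mul, abs_of_nonneg hc0]
          exact mul_le_of_le_one_left (abs_nonneg _) hc1
        calc |G x (c • y) - c * G x y| ≤ |G x (c • y)| + |c * G x y| := abs_sub _ _
          _ ≤ _ := by linarith) c
    change G x (c • y) - c * G x y = 0 at this
    linarith
  refine ⟨LinearMap.mk₂ ℝ G (fun x y z => ?_) (fun c x y => ?_) hadd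
    (fun c x y => hsmul c x y), hsymm, fun x => ?_⟩
  · rw [hsymm, hadd, hsymm z, hsymm z]
  · rw [hsymm, hsmul, hsymm y, smul_eq_mul]
  · change G x x = F x
    have := hs 2 x
    simp only [G, ← two_smul ℝ x, this, sub_self, hzero]
    ring

end Parallelogram

/-! ### The positive real lemma through a discretized required supply -/

section Storage

variable {n : ℕ}

/-- The state `ξ` is reached from rest by a trajectory of the implicit midpoint discretization of
the system `(A, B, C, D)` with the supply `q`. Time is counted backwards, `z k` is the midpoint of
the `k`-th last step and `u k` the input in this step. -/
def Supplies (A : Matrix (Fin n) (Fin n) ℝ) (B C : Fin n → ℝ) (D : ℝ) (ξ : Fin n → ℝ) (q : ℝ) :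
    Prop :=
  ∃ (N : ℕ) (z : ℕ → Fin n → ℝ) (u : ℕ → ℝ), (∀ k, N ≤ k → z k = 0 ∧ u k = 0) ∧
    (∀ k, z k - (A *ᵥ z k + u k • B) = z (k + 1) + (A *ᵥ z (k + 1) + u (k + 1) • B)) ∧
    z 0 + (A *ᵥ z 0 + u 0 • B) = ξ ∧ ∑ k ∈ Finset.range N, u k * (C ⬝ᵥ z k + D * u k) = q

variable {A : Matrix (Fin n) (Fin n) ℝ} {B C : Fin n → ℝ} {D : ℝ}

namespace Supplies

theorem zero : Supplies A B C D 0 0 :=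
  ⟨0, fun _ => 0, fun _ => 0, by simp, by simp, by simp, by simp⟩

/-- The new last step has midpoint `z` and runs from `z - g` to `z + g`, where `g = A *ᵥ z + c • B`.
Time is counted backwards, so it is inserted at index `0`. -/
theorem step {ξ : Fin n → ℝ} {q : ℝ} (h : Supplies A B C D ξ q) {z : Fin n → ℝ} {c : ℝ}
    (hz : z - (A *ᵥ z + c • B) = ξ) :
    Supplies A B C D (z + (A *ᵥ z + c • B)) (q + c * (C ⬝ᵥ z + D * c)) := by
  obtain ⟨N, Z, u, h0, hs, hξ, hq⟩ := h
  refine ⟨N + 1, fun k => Nat.casesOn k z Z, fun k => Nat.casesOn k c u, ?_, ?_, rfl, ?_⟩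
  · rintro (_ | k) hk
    · omega
    · exact h0 k (by omega)
  · rintro (_ | k)
    · exact hz.trans hξ.symm
    · exact hs k
  · rw [Finset.sum_range_succ', ← hq]
    rfl

theorem smul {ξ : Fin n → ℝ} {q : ℝ} (h : Supplies A B C D ξ q) (c : ℝ) :
    Supplies A B C D (c • ξ) (c ^ 2 * q) := by
  obtain ⟨N, Z, u, h0, hs, hξ, hq⟩ := h
  refine ⟨N, fun k => c • Z k, fun k => c * u k, fun k hk => ?_, fun k => ?_, ?_, ?_⟩
  · simp [h0 k hk]
  · have := congrArg (fun v => c • v) (hs k)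
    simpa only [smul_sub, smul_add, Matrix.mulVec_smul, smul_smul] using this
  · rw [← hξ]
    simp only [smul_add, Matrix.mulVec_smul, smul_smul]
  · rw [← hq, Finset.mul_sum]
    refine Finset.sum_congr rfl fun k _ => ?_
    rw [dotProduct_smul, smul_eq_mul]
    ring

/-- Trajectories add and subtract, and the supply is a quadratic function of the trajectory. The two
horizons are first made equal by padding with zeros. -/
theorem parallelogram {ξ ξ' : Fin n → ℝ} {q q' : ℝ} (h : Supplies A B C D ξ q)
    (h' : Supplies A B C D ξ' q') : ∃ p p' : ℝ, Supplies A B C D (ξ + ξ') p ∧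
      Supplies A B C D (ξ - ξ') p' ∧ p + p' = 2 * q + 2 * q' := by
  obtain ⟨N, Z, u, h0, hs, hξ, hq⟩ := h
  obtain ⟨N', Z', u', h0', hs', hξ', hq'⟩ := h'
  have ext : ∀ (M L : ℕ) (z : ℕ → Fin n → ℝ) (v : ℕ → ℝ), M ≤ L →
      (∀ k, M ≤ k → z k = 0 ∧ v k = 0) →
      ∑ k ∈ Finset.range M, v k * (C ⬝ᵥ z k + D * v k)
        = ∑ k ∈ Finset.range L, v k * (C ⬝ᵥ z k + D * v k) := by
    intro M L z v hML hv
    refine Finset.sum_subset (Finset.range_mono hML) fun k _ hk => ?_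
    rw [Finset.mem_range, not_lt] at hk
    rw [(hv k hk).2, zero_mul]
  rw [ext N (max N N') Z u (le_max_left _ _) h0] at hq
  rw [ext N' (max N N') Z' u' (le_max_right _ _) h0'] at hq'
  refine ⟨_, _, ⟨max N N', fun k => Z k + Z' k, fun k => u k + u' k, fun k hk => ?_, fun k => ?_,
    ?_, rfl⟩, ⟨max N N', fun k => Z k - Z' k, fun k => u k - u' k, fun k hk => ?_, fun k => ?_,
    ?_, rfl⟩, ?_⟩
  · obtain ⟨h1, h2⟩ := max_le_iff.1 hk
    simp [h0 k h1, h0' k h2]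
  · simp only [Matrix.mulVec_add, add_smul]
    linear_combination hs k + hs' k
  · rw [← hξ, ← hξ']
    simp only [Matrix.mulVec_add, add_smul]
    abel
  · obtain ⟨h1, h2⟩ := max_le_iff.1 hk
    simp [h0 k h1, h0' k h2]
  · simp only [Matrix.mulVec_sub, sub_smul]
    linear_combination hs k - hs' k
  · rw [← hξ, ← hξ']
    simp only [Matrix.mulVec_sub, sub_smul]
    abel
  · rw [← hq, ← hq', ← Finset.sum_add_distrib, Finset.mul_sum, Finset.mul_sum,
      ← Finset.sum_add_distrib]
    refine Finset.sum_congr rfl fun k _ => ?_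
    rw [dotProduct_add, dotProduct_sub]
    ring

end Supplies

/-- The shift rule for generating functions. One boundary term disappears by `hb`; the other, of
order `N + 1`, is what the circle inequality ignores. -/
theorem smul_sum_pow_sub_smul {M : Type*} [AddCommGroup M] [Module ℂ M] (v : ℂ) (N : ℕ)
    (b : ℕ → M) (hb : b N = 0) :
    v • ∑ k ∈ Finset.range N, v ^ (N - k) • b k
      = v ^ (N + 1) • b 0 + ∑ k ∈ Finset.range N, v ^ (N - k) • b (k + 1) := by
  have h1 : ∑ k ∈ Finset.range (N + 1), v ^ (N + 1 - k) • b k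
      = v • ∑ k ∈ Finset.range N, v ^ (N - k) • b k := by
    rw [Finset.sum_range_succ, hb, smul_zero, add_zero, Finset.smul_sum]
    refine Finset.sum_congr rfl fun k hk => ?_
    rw [smul_smul, ← pow_succ', Nat.sub_add_comm (Finset.mem_range.1 hk).le]
  rw [← h1, Finset.sum_range_succ', add_comm]
  simp

/-- Discretized passivity: a positive real system cannot release energy from rest. -/
theorem IsMinimalRealization.supply_nonneg {H : RatFunc ℝ} (h : IsMinimalRealization H A B C D)
    (hPR : PositiveReal H) {ξ : Fin n → ℝ} {q : ℝ} (hq : Supplies A B C D ξ q) : 0 ≤ q := by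
  obtain ⟨p, hp⟩ := h.exists_polynomial_output ξ
  obtain ⟨N, z, u, h0, hs, hξ, rfl⟩ := hq
  have hv1 : ∀ v : ℂ, ‖v‖ < 1 → 1 + v ≠ 0 := by
    intro v hv h1
    have : v = -1 := by linear_combination h1
    rw [this] at hv
    simp at hv
  have hspos : ∀ v : ℂ, ‖v‖ < 1 → 0 < ((1 - v) / (1 + v)).re := by
    intro v hv
    have h2 : 0 < Complex.normSq (1 + v) := Complex.normSq_pos.2 (hv1 v hv)
    have h3 : Complex.normSq v < 1 := by
      rw [Complex.normSq_eq_norm_sq]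
      have := norm_nonneg v
      nlinarith
    rw [Complex.div_re, ← add_div]
    apply div_pos _ h2
    rw [Complex.normSq_apply] at h3
    simp
    nlinarith
  have hden : ∀ v : ℂ, ‖v‖ < 1 → H.denom.eval₂ (algebraMap ℝ ℂ) ((1 - v) / (1 + v)) ≠ 0 :=
    fun v hv hd => (hPR _ (hspos v hv)).1 (isPole_iff.2 hd)
  -- The Cayley map `v ↦ (1 - v) / (1 + v)` carries the unit disc to the open right half-plane. The
  -- tail `h` is chosen to cancel the effect of the final state `ξ` on the output.
  refine sum_mul_nonneg_of_circle N u (fun k => C ⬝ᵥ z k + D * u k)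
    (fun v => (1 + v)⁻¹ * (p.eval₂ (algebraMap ℝ ℂ) ((1 - v) / (1 + v))
      / H.denom.eval₂ (algebraMap ℝ ℂ) ((1 - v) / (1 + v)))) ?_ ?_
  · intro v hv
    have hv' : ‖v‖ < 1 := by simpa using hv
    have hpol : ∀ P : Polynomial ℝ, Differentiable ℂ fun s => P.eval₂ (algebraMap ℝ ℂ) s := by
      intro P
      simp only [← Polynomial.eval_map]
      exact Polynomial.differentiable _
    have hd1 : DifferentiableAt ℂ (fun v : ℂ => (1 - v) / (1 + v)) v :=
      DifferentiableAt.div (by fun_prop) (by fun_prop) (hv1 v hv')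
    have hcomp : ∀ P : Polynomial ℝ, DifferentiableAt ℂ
        (fun v : ℂ => P.eval₂ (algebraMap ℝ ℂ) ((1 - v) / (1 + v))) v := fun P =>
      DifferentiableAt.comp v (hpol P _) hd1
    have hd2 : DifferentiableAt ℂ (fun v : ℂ => (1 + v)⁻¹) v :=
      DifferentiableAt.inv (by fun_prop) (hv1 v hv')
    exact (hd2.mul ((hcomp p).div (hcomp _) (hden v hv'))).differentiableWithinAt
  · intro v hv
    set s := (1 - v) / (1 + v) with hsdef
    let zc : ℕ → Fin n → ℂ := fun k i => (z k i : ℂ)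
    set Bc : Fin n → ℂ := fun i => (B i : ℂ) with hBc
    set ξc : Fin n → ℂ := fun i => (ξ i : ℂ) with hξc
    set Ac := A.map (algebraMap ℝ ℂ) with hAc
    let g : ℕ → Fin n → ℂ := fun k => Ac *ᵥ zc k + (u k : ℂ) • Bc
    have hgr : ∀ k i, g k i = (((A *ᵥ z k + u k • B) i : ℝ) : ℂ) := by
      intro k i
      simp [g, zc, hAc, hBc, Matrix.mulVec, dotProduct]
    have hgs : ∀ k, zc k - g k = zc (k + 1) + g (k + 1) := by
      intro k
      ext i
      have := congrFun (hs k) i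
      simp only [Pi.sub_apply, Pi.add_apply, hgr, zc] at this ⊢
      rw [← Complex.ofReal_sub, ← Complex.ofReal_add]
      exact_mod_cast this
    have hg0 : zc 0 + g 0 = ξc := by
      ext i
      have := congrFun hξ i
      simp only [Pi.add_apply, hgr, zc, hξc] at this ⊢
      rw [← Complex.ofReal_add]
      exact_mod_cast this
    have hgN : zc N + g N = 0 := by
      ext i
      simp [g, zc, h0 N le_rfl, Matrix.mulVec, dotProduct]
    set Zt : Fin n → ℂ := ∑ k ∈ Finset.range N, v ^ (N - k) • zc k with hZt
    set Ut : ℂ := ∑ k ∈ Finset.range N, v ^ (N - k) * (u k : ℂ) with hUt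
    have hgsum : ∑ k ∈ Finset.range N, v ^ (N - k) • g k = Ac *ᵥ Zt + Ut • Bc := by
      simp only [g, smul_add, Finset.sum_add_distrib, hZt, hUt, Matrix.mulVec_sum, Finset.sum_smul,
        Matrix.mulVec_smul, smul_smul]
    -- The midpoint recursion summed against `v ^ (N - k)`; division by `1 + v` makes it a resolvent
    -- equation at `s`.
    have hmain : (1 - v) • Zt = (1 + v) • (Ac *ᵥ Zt + Ut • Bc) - v ^ (N + 1) • ξc := by
      have h1 := smul_sum_pow_sub_smul v N (fun k => zc k + g k) hgN
      simp only [← hgs, hg0] at h1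
      simp only [smul_add, smul_sub, Finset.sum_add_distrib, Finset.sum_sub_distrib] at h1
      rw [hgsum, ← hZt] at h1
      simp only [smul_add] at h1 ⊢
      ext i
      have h2 := congrFun h1 i
      simp only [Pi.add_apply, Pi.sub_apply, Pi.smul_apply, smul_eq_mul] at h2 ⊢
      linear_combination -h2
    have hz : s • Zt - Ac *ᵥ Zt = Ut • Bc + (-(v ^ (N + 1) / (1 + v))) • ξc := by
      ext i
      have h2 := congrFun hmain i
      simp only [Pi.add_apply, Pi.sub_apply, Pi.smul_apply, smul_eq_mul] at h2 ⊢
      have := hv1 v hv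
      rw [hsdef]
      field_simp
      linear_combination h2
    have hout := hp s Zt _ _ (hden v hv) hz
    have hY : ∑ k ∈ Finset.range N, v ^ (N - k) * ((C ⬝ᵥ z k + D * u k : ℝ) : ℂ)
        = (fun i => (C i : ℂ)) ⬝ᵥ Zt + D * Ut := by
      rw [hZt, hUt, dotProduct_sum, Finset.mul_sum, ← Finset.sum_add_distrib]
      refine Finset.sum_congr rfl fun k _ => ?_
      rw [dotProduct_smul]
      simp only [zc, dotProduct, smul_eq_mul]
      push_cast
      ring
    rw [hY, hout]
    -- What remains is `conj U * H(s) U`, whose real part is `|U| ^ 2 Re H(s)`.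
    have : RatFunc.eval (algebraMap ℝ ℂ) s H * Ut
        + -(v ^ (N + 1) / (1 + v)) * (p.eval₂ (algebraMap ℝ ℂ) s
          / H.denom.eval₂ (algebraMap ℝ ℂ) s)
        + v ^ (N + 1) * ((1 + v)⁻¹ * (p.eval₂ (algebraMap ℝ ℂ) s
          / H.denom.eval₂ (algebraMap ℝ ℂ) s)) = RatFunc.eval (algebraMap ℝ ℂ) s H * Ut := by
      ring
    rw [this, mul_left_comm, mul_comm (starRingEnd ℂ Ut), Complex.mul_conj, mul_comm,
      Complex.re_ofReal_mul]
    exact mul_nonneg (Complex.normSq_nonneg _) (hPR s (hspos v hv)).2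

/-- If `1` is not an eigenvalue, then every state of a minimal realization is reached from rest by
the implicit midpoint discretization. -/
theorem IsMinimalRealization.exists_supply {H : RatFunc ℝ} (h : IsMinimalRealization H A B C D)
    (hA : ∀ v : Fin n → ℝ, A *ᵥ v = v → v = 0) (ξ : Fin n → ℝ) : ∃ q, Supplies A B C D ξ q := by
  let W : Submodule ℝ (Fin n → ℝ) :=
    { carrier := {ξ | ∃ q, Supplies A B C D ξ q}
      add_mem' := fun ⟨q, hq⟩ ⟨q', hq'⟩ => by
        obtain ⟨p, -, hp, -⟩ := hq.parallelogram hq'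
        exact ⟨p, hp⟩
      zero_mem' := ⟨0, Supplies.zero⟩
      smul_mem' := fun c ξ ⟨q, hq⟩ => ⟨_, hq.smul c⟩ }
  let L : (Fin n → ℝ) →ₗ[ℝ] (Fin n → ℝ) := LinearMap.id - A.mulVecLin
  have hLv : ∀ v, L v = v - A *ᵥ v := fun v => rfl
  have hinj : Function.Injective L := by
    rw [injective_iff_map_eq_zero]
    intro v hv
    rw [hLv, sub_eq_zero] at hv
    exact hA v hv.symm
  have hsurj : Function.Surjective L := LinearMap.surjective_of_injective hinj
  -- A step from `ξ` with input `c` has its midpoint at the solution `z` of `(1 - A) z = ξ + c B`.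
  -- This midpoint is the mean of the two reachable end states.
  have key : ∀ (ξ : Fin n → ℝ) (c : ℝ) (z : Fin n → ℝ), ξ ∈ W → L z = ξ + c • B → z ∈ W := by
    rintro ξ c z ⟨q, hq⟩ hz
    rw [hLv] at hz
    have hz' : z - (A *ᵥ z + c • B) = ξ := by
      rw [← sub_sub, hz, add_sub_cancel_right]
    have h1 : z + (A *ᵥ z + c • B) ∈ W := ⟨_, hq.step hz'⟩
    have h2 : z = (1 / 2 : ℝ) • (z + (A *ᵥ z + c • B) + ξ) := by
      rw [← hz']
      module
    rw [h2]
    exact W.smul_mem _ (W.add_mem h1 ⟨q, hq⟩)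
  have hinv : ∀ v ∈ W, L v ∈ W := by
    let e := LinearEquiv.ofBijective L ⟨hinj, hsurj⟩
    -- Inputs `c = 0` show that `W` is stable under the inverse of `L = 1 - A`; by dimension it is
    -- then stable under `L`, hence under `A`.
    have hle : W.map (e.symm : (Fin n → ℝ) →ₗ[ℝ] (Fin n → ℝ)) ≤ W := by
      rintro _ ⟨v, hv, rfl⟩
      exact key v 0 _ hv (by rw [zero_smul, add_zero]; exact e.apply_symm_apply v)
    have heq : W.map (e.symm : (Fin n → ℝ) →ₗ[ℝ] (Fin n → ℝ)) = W :=
      Submodule.eq_of_le_of_finrank_eq hle (LinearEquiv.finrank_map_eq e.symm W)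
    intro v hv
    rw [← heq] at hv
    obtain ⟨w, hw, rfl⟩ := hv
    have : L (e.symm w) = w := e.apply_symm_apply w
    change L (e.symm w) ∈ W
    rw [this]
    exact hw
  have htop : W = ⊤ := by
    refine h.eq_top_of_invariant W (fun v hv => ?_) ?_
    · have := W.sub_mem hv (hinv v hv)
      rwa [hLv, sub_sub_cancel] at this
    · obtain ⟨z, hz⟩ := hsurj B
      rw [← hz]
      exact hinv z (key 0 1 z W.zero_mem (by rw [hz, one_smul, zero_add]))
  have : ξ ∈ W := by rw [htop]; trivial
  exact this

/-- The positive real lemma, with the storage function as a bilinear form. -/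
theorem IsMinimalRealization.exists_storage {H : RatFunc ℝ} (h : IsMinimalRealization H A B C D)
    (hPR : PositiveReal H) : 0 ≤ D ∧ ∃ β : LinearMap.BilinForm ℝ (Fin n → ℝ),
      (∀ x y, β x y = β y x) ∧ (∀ x, x ≠ 0 → 0 < β x x) ∧
      ∀ (z : Fin n → ℝ) (c : ℝ), β z (A *ᵥ z + c • B) ≤ c * (C ⬝ᵥ z + D * c) := by
  -- An eigenvalue `1` would be a pole in the open right half-plane. Its absence makes the implicit
  -- step solvable.
  have hA : ∀ v : Fin n → ℝ, A *ᵥ v = v → v = 0 := by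
    intro v hv
    by_contra hv0
    have h1 := h.denom_eval_eq_zero_of_eigenvector (s := 1) (w := fun i => (v i : ℂ))
      (fun h0 => hv0 (by ext i; simpa using congrFun h0 i)) (by
        rw [one_smul]
        ext i
        have := congrFun hv i
        simp only [Matrix.mulVec, dotProduct, Matrix.map_apply, Complex.coe_algebraMap] at this ⊢
        exact_mod_cast this)
    exact (hPR 1 (by simp)).1 (isPole_iff.2 h1)
  have hex := h.exists_supply hA
  have hnn : ∀ {ξ q}, Supplies A B C D ξ q → 0 ≤ q := fun hq => h.supply_nonneg hPR hq
  -- The required supply: the least energy that brings the system from rest to `ξ`.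
  let F : (Fin n → ℝ) → ℝ := fun ξ => sInf {q | Supplies A B C D ξ q}
  have hbdd : ∀ ξ, BddBelow {q | Supplies A B C D ξ q} := fun ξ => ⟨0, fun q hq => hnn hq⟩
  have hF0 : ∀ ξ, 0 ≤ F ξ := fun ξ => Real.sInf_nonneg fun q hq => hnn hq
  have hFle : ∀ {ξ q}, Supplies A B C D ξ q → F ξ ≤ q := fun {ξ q} hq => csInf_le (hbdd ξ) hq
  have hFge : ∀ ξ m, (∀ q, Supplies A B C D ξ q → m ≤ q) → m ≤ F ξ := fun ξ m hm =>
    le_csInf (hex ξ) hm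
  have hsle : ∀ (c : ℝ) ξ, c ≠ 0 → F (c • ξ) ≤ c ^ 2 * F ξ := by
    intro c ξ hc
    have hc2 : 0 < c ^ 2 := by positivity
    rw [← div_le_iff₀' hc2]
    refine hFge _ _ fun q hq => ?_
    rw [div_le_iff₀' hc2]
    exact hFle (hq.smul c)
  have hs : ∀ (c : ℝ) ξ, F (c • ξ) = c ^ 2 * F ξ := by
    intro c ξ
    rcases eq_or_ne c 0 with rfl | hc
    · have : F 0 = 0 := le_antisymm (hFle Supplies.zero) (hF0 0)
      simp [this]
    · refine le_antisymm (hsle c ξ hc) ?_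
      have := hsle c⁻¹ (c • ξ) (inv_ne_zero hc)
      rw [smul_smul, inv_mul_cancel₀ hc, one_smul, inv_pow, ← div_eq_inv_mul,
        le_div_iff₀' (by positivity)] at this
      exact this
  have hple : ∀ x y, F (x + y) + F (x - y) ≤ 2 * F x + 2 * F y := by
    intro x y
    have h1 : ∀ q, Supplies A B C D x q → (F (x + y) + F (x - y)) / 2 - q ≤ F y := by
      intro q hq
      refine hFge _ _ fun q' hq' => ?_
      obtain ⟨p, p', hp, hp', hpp⟩ := hq.parallelogram hq'
      linarith [hFle hp, hFle hp']
    have h2 : (F (x + y) + F (x - y)) / 2 - F y ≤ F x := by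
      refine hFge _ _ fun q hq => ?_
      linarith [h1 q hq]
    linarith
  have hp : ∀ x y, F (x + y) + F (x - y) = 2 * F x + 2 * F y := by
    intro x y
    refine le_antisymm (hple x y) ?_
    have := hple (x + y) (x - y)
    have e1 : x + y + (x - y) = (2 : ℝ) • x := by module
    have e2 : x + y - (x - y) = (2 : ℝ) • y := by module
    rw [e1, e2, hs, hs] at this
    linarith
  obtain ⟨β, hsymm, hβ⟩ := exists_bilinForm_of_parallelogram F hF0 hp hs
  -- Reaching `z - g` and making one more step bounds `F (z + g) - F (z - g)`, which by polarization
  -- is `4 β z g`; hence the factor `4`.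
  have hdiss : ∀ (z : Fin n → ℝ) (c : ℝ),
      4 * β z (A *ᵥ z + c • B) ≤ c * (C ⬝ᵥ z + D * c) := by
    intro z c
    set g := A *ᵥ z + c • B with hg
    have h1 : F (z + g) - c * (C ⬝ᵥ z + D * c) ≤ F (z - g) := by
      refine hFge _ _ fun q hq => ?_
      linarith [hFle (hq.step (z := z) (c := c) rfl)]
    rw [← hβ, ← hβ] at h1
    simp only [map_add, map_sub, LinearMap.add_apply, LinearMap.sub_apply, hsymm g z] at h1
    linarith
  have hD : 0 ≤ D := by
    have := hdiss 0 1
    simpa using this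
  have hβ0 : ∀ x, 0 ≤ β x x := fun x => by rw [hβ]; exact hF0 x
  -- Near `t = 0` the linear term dominates. The chosen `t` has the sign opposite to `a` and is
  -- small enough to absorb `b`.
  have hker : ∀ (f : ℝ → ℝ) (a b : ℝ), (∀ t, f t = a * t + b * t ^ 2) → (∀ t, 0 ≤ f t) →
      a = 0 := by
    intro f a b hf hf0
    by_contra ha
    have h1 := hf0 (-a / (2 * (|b| + 1)))
    rw [hf] at h1
    have hb : 0 < |b| + 1 := by positivity
    have h2 : a * (-a / (2 * (|b| + 1))) + b * (-a / (2 * (|b| + 1))) ^ 2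
        = -(a ^ 2 * (2 * (|b| + 1) - b)) / (4 * (|b| + 1) ^ 2) := by
      field_simp
      ring
    rw [h2] at h1
    have h3 : 0 < a ^ 2 * (2 * (|b| + 1) - b) := by
      have := le_abs_self b
      have : 0 < 2 * (|b| + 1) - b := by linarith [abs_nonneg b]
      positivity
    have h4 : -(a ^ 2 * (2 * (|b| + 1) - b)) / (4 * (|b| + 1) ^ 2) < 0 :=
      div_neg_of_neg_of_pos (by linarith) (by positivity)
    linarith
  have hnull : ∀ x, β x x = 0 → ∀ y, β x y = 0 := by
    intro x hx y
    refine (mul_eq_zero.1 (hker (fun t => β (x + t • y) (x + t • y)) (2 * β x y) (β y y)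
      (fun t => ?_) fun t => hβ0 _)).resolve_left two_ne_zero
    simp only [map_add, map_smul, LinearMap.add_apply, LinearMap.smul_apply, smul_eq_mul,
      hsymm y x, hx]
    ring
  have hnullC : ∀ x, β x x = 0 → C ⬝ᵥ x = 0 := by
    intro x hx
    refine hker (fun t => t * (C ⬝ᵥ x + D * t)) (C ⬝ᵥ x) D (fun t => by ring) fun t => ?_
    refine le_trans (le_of_eq ?_) (hdiss x t)
    rw [hnull x hx, mul_zero]
  -- First-order variation of the dissipation inequality without input along `x + t A x`. Thus null
  -- vectors of `β` form an `A`-invariant set inside the kernel of `C`, and observability makes `β`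
  -- definite.
  have hnullA : ∀ x, β x x = 0 → β (A *ᵥ x) (A *ᵥ x) = 0 := by
    intro x hx
    have h1 := hker (fun t => -(β (x + t • (A *ᵥ x)) (A *ᵥ (x + t • (A *ᵥ x)))))
      (-(β (A *ᵥ x) (A *ᵥ x))) (-(β (A *ᵥ x) (A *ᵥ (A *ᵥ x)))) (fun t => ?_) (fun t => ?_)
    · linarith
    · simp only [Matrix.mulVec_add, Matrix.mulVec_smul, map_add, map_smul, LinearMap.add_apply,
        LinearMap.smul_apply, smul_eq_mul, hnull x hx]
      ring
    · have := hdiss (x + t • (A *ᵥ x)) 0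
      simp only [zero_smul, add_zero, zero_mul] at this
      linarith
  refine ⟨hD, 4 • β, fun x y => ?_, fun x hx => ?_, fun z c => ?_⟩
  · simp [hsymm x y]
  · have hpos : 0 < β x x := by
      refine lt_of_le_of_ne (hβ0 x) fun h0 => hx ?_
      have hpow : ∀ k : ℕ, β (A ^ k *ᵥ x) (A ^ k *ᵥ x) = 0 := by
        intro k
        induction k with
        | zero => simpa using h0.symm
        | succ k ih =>
          rw [pow_succ', ← Matrix.mulVec_mulVec]
          exact hnullA _ ih
      exact h.eq_zero_of_unobservable fun k => hnullC _ (hpow k)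
    simp [hpos]
  · have := hdiss z c
    simpa [mul_add] using this

end Storage

/-! ### Sector bounds for the quantizer and behaviour at crossings -/

section Quantizer

theorem filledQuantizer_le_quantizer {Δ : ℝ} (hΔ : 0 < Δ) {y z v : ℝ} (hyz : y ≤ z)
    (hv : v ∈ filledQuantizer Δ y) : v ≤ quantizer Δ z := by
  refine hv.2.trans ?_
  have : ⌊y / Δ + 1 / 2⌋ ≤ ⌊z / Δ + 1 / 2⌋ := by gcongr
  have h : (⌊y / Δ + 1 / 2⌋ : ℝ) ≤ ⌊z / Δ + 1 / 2⌋ := by exact_mod_cast this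
  exact mul_le_mul_of_nonneg_right h hΔ.le

/-- Strictness of `z < y` matters: on a level `quantizer` takes the upper end of the filled segment.
-/
theorem quantizer_le_filledQuantizer {Δ : ℝ} (hΔ : 0 < Δ) {y z v : ℝ} (hzy : z < y)
    (hv : v ∈ filledQuantizer Δ y) : quantizer Δ z ≤ v := by
  refine le_trans ?_ hv.1
  have h1 : z / Δ < y / Δ := by gcongr
  have : ⌊z / Δ + 1 / 2⌋ ≤ ⌈y / Δ - 1 / 2⌉ := by
    have h2 : (⌊z / Δ + 1 / 2⌋ : ℝ) < ((⌈y / Δ - 1 / 2⌉ + 1 : ℤ) : ℝ) := by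
      push_cast
      linarith [Int.floor_le (z / Δ + 1 / 2), Int.le_ceil (y / Δ - 1 / 2)]
    have h3 : ⌊z / Δ + 1 / 2⌋ < ⌈y / Δ - 1 / 2⌉ + 1 := by exact_mod_cast h2
    omega
  have h : (⌊z / Δ + 1 / 2⌋ : ℝ) ≤ ⌈y / Δ - 1 / 2⌉ := by exact_mod_cast this
  exact mul_le_mul_of_nonneg_right h hΔ.le

/-- Monotonicity of the quantizer, filled values included. This sign is the passivity of the
feedback. -/
theorem mul_quantizer_sub_nonneg {Δ : ℝ} (hΔ : 0 < Δ) {y z v : ℝ}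
    (hv : v ∈ filledQuantizer Δ y) : 0 ≤ (z - y) * (quantizer Δ z - v) := by
  rcases le_or_gt y z with h | h
  · exact mul_nonneg (sub_nonneg.2 h) (sub_nonneg.2 (filledQuantizer_le_quantizer hΔ h hv))
  · exact mul_nonneg_of_nonpos_of_nonpos (sub_nonpos.2 h.le)
      (sub_nonpos.2 (quantizer_le_filledQuantizer hΔ h hv))

theorem abs_quantizer_sub_le {Δ : ℝ} (hΔ : 0 < Δ) {y z v : ℝ}
    (hv : v ∈ filledQuantizer Δ y) : |quantizer Δ z - v| ≤ |z - y| + Δ := by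
  have hz1 : quantizer Δ z ≤ z + Δ / 2 := by
    have := mul_le_mul_of_nonneg_right (Int.floor_le (z / Δ + 1 / 2)) hΔ.le
    have h2 : (z / Δ + 1 / 2) * Δ = z + Δ / 2 := by field_simp
    rw [h2] at this
    exact this
  have hz2 : z - Δ / 2 ≤ quantizer Δ z := by
    have := mul_le_mul_of_nonneg_right (Int.lt_floor_add_one (z / Δ + 1 / 2)).le hΔ.le
    have h2 : (z / Δ + 1 / 2) * Δ = z + Δ / 2 := by field_simp
    rw [h2, add_mul, one_mul] at this
    rw [quantizer]
    linarith
  have hv2 : v ≤ y + Δ / 2 := by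
    refine hv.2.trans ?_
    have := mul_le_mul_of_nonneg_right (Int.floor_le (y / Δ + 1 / 2)) hΔ.le
    have h2 : (y / Δ + 1 / 2) * Δ = y + Δ / 2 := by field_simp
    rwa [h2] at this
  have hv1 : y - Δ / 2 ≤ v := by
    refine le_trans ?_ hv.1
    have := mul_le_mul_of_nonneg_right (Int.le_ceil (y / Δ - 1 / 2)) hΔ.le
    have h2 : (y / Δ - 1 / 2) * Δ = y - Δ / 2 := by field_simp
    rwa [h2] at this
  have h1 := le_abs_self (z - y)
  have h2 := neg_abs_le (z - y)
  rw [abs_le]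
  constructor <;> linarith

/-- The distance to the quantization levels `(j + 1/2) Δ`. -/
noncomputable def levelDist (Δ z : ℝ) : ℝ := |z / Δ + 1 / 2 - round (z / Δ + 1 / 2)| * Δ

theorem levelDist_le {Δ : ℝ} (hΔ : 0 < Δ) (z : ℝ) (j : ℤ) :
    levelDist Δ z ≤ |z - ((j : ℝ) + 1 / 2) * Δ| := by
  have h := round_le (z / Δ + 1 / 2) (j + 1)
  have e : z - ((j : ℝ) + 1 / 2) * Δ = (z / Δ + 1 / 2 - ((j + 1 : ℤ) : ℝ)) * Δ := by
    push_cast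
    field_simp
    ring
  rw [e, abs_mul, abs_of_pos hΔ]
  exact mul_le_mul_of_nonneg_right h hΔ.le

theorem exists_level_of_levelDist_eq_zero {Δ : ℝ} (hΔ : 0 < Δ) {z : ℝ} (h : levelDist Δ z = 0) :
    ∃ j : ℤ, z = ((j : ℝ) + 1 / 2) * Δ := by
  refine ⟨round (z / Δ + 1 / 2) - 1, ?_⟩
  have h1 := abs_eq_zero.1 ((mul_eq_zero.1 h).resolve_right hΔ.ne')
  push_cast
  have : z / Δ = round (z / Δ + 1 / 2) - 1 / 2 := by linarith
  rw [div_eq_iff hΔ.ne'] at this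
  linear_combination this

theorem levelDist_nonneg {Δ : ℝ} (hΔ : 0 < Δ) (z : ℝ) : 0 ≤ levelDist Δ z :=
  mul_nonneg (abs_nonneg _) hΔ.le

theorem measurable_levelDist (Δ : ℝ) : Measurable (levelDist Δ) := by
  unfold levelDist
  have : Measurable fun z : ℝ => ((round (z / Δ + 1 / 2) : ℤ) : ℝ) := by
    simp only [round_eq]
    exact (measurable_from_top (f := fun k : ℤ => (k : ℝ))).comp (by fun_prop)
  fun_prop

/-- Either `|z - y| ≥ η`, or no level separates `y` from `z` and the quantized values coincide. It
bounds `|u|` by the extracted energy away from the levels. -/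
theorem mul_abs_quantizer_sub_le {Δ : ℝ} (hΔ : 0 < Δ) {y z v η : ℝ}
    (hv : v ∈ filledQuantizer Δ y) (hη : η ≤ levelDist Δ z) :
    η * |quantizer Δ z - v| ≤ (z - y) * (quantizer Δ z - v) := by
  rw [← abs_of_nonneg (mul_quantizer_sub_nonneg (z := z) hΔ hv), abs_mul]
  by_cases h : η ≤ |z - y|
  · exact mul_le_mul_of_nonneg_right h (abs_nonneg _)
  · push Not at h
    obtain ⟨j, hj⟩ := exists_mem_region hΔ z
    have h1 := hη.trans (levelDist_le hΔ z j)
    have h2 := hη.trans (levelDist_le hΔ z (j - 1))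
    push_cast at h2
    rw [abs_of_nonpos (by linarith [hj.2])] at h1
    rw [abs_of_nonneg (by linarith [hj.1])] at h2
    have h3 := abs_lt.1 h
    have hy := filledQuantizer_of_interior (z := y) hΔ (j := j) (by linarith) (by linarith)
    have hy2 := quantizer_eq_of_mem_region (z := y) hΔ (j := j) ⟨by linarith, by linarith⟩
    rw [hy, Set.mem_singleton_iff, hy2] at hv
    rw [quantizer_eq_of_mem_region hΔ hj, hv]
    simp

/-- By continuity `r t` lies in the closures of both regions, so they are adjacent and `r t` is
their common level. The direction of crossing is forgotten: only one side below and one above is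
needed. -/
theorem CrossesAt.exists_level {Δ : ℝ} (hΔ : 0 < Δ) {r : ℝ → ℝ} (hr : Continuous r) {t : ℝ}
    (h : CrossesAt Δ r t) : ∃ i : ℤ, r t = ((i : ℝ) + 1 / 2) * Δ ∧
      (∀ ε > 0, ∃ a b, a < b ∧ Set.Ioo a b ⊆ Metric.ball t ε ∧
        ∀ s ∈ Set.Ioo a b, r s ∈ region Δ i) ∧
      (∀ ε > 0, ∃ a b, a < b ∧ Set.Ioo a b ⊆ Metric.ball t ε ∧
        ∀ s ∈ Set.Ioo a b, r s ∈ region Δ (i + 1)) := by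
  obtain ⟨i, j, hij, hl, hr'⟩ := h
  have hleft : ∀ ε > 0, ∃ a b, a < b ∧ Set.Ioo a b ⊆ Metric.ball t ε ∧
        ∀ s ∈ Set.Ioo a b, r s ∈ region Δ i := by
    intro ε hε
    obtain ⟨l, hlt, hl'⟩ := mem_nhdsLT_iff_exists_Ioo_subset.1 hl
    refine ⟨max l (t - ε), t, max_lt hlt (by linarith), fun s hs => ?_, fun s hs => ?_⟩
    · rw [Real.ball_eq_Ioo]
      exact ⟨(le_max_right _ _).trans_lt hs.1, by linarith [hs.2]⟩
    · exact hl' ⟨(le_max_left _ _).trans_lt hs.1, hs.2⟩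
  have hright : ∀ ε > 0, ∃ a b, a < b ∧ Set.Ioo a b ⊆ Metric.ball t ε ∧
        ∀ s ∈ Set.Ioo a b, r s ∈ region Δ j := by
    intro ε hε
    obtain ⟨l, hlt, hl'⟩ := mem_nhdsGT_iff_exists_Ioo_subset.1 hr'
    refine ⟨t, min l (t + ε), lt_min hlt (by linarith), fun s hs => ?_, fun s hs => ?_⟩
    · rw [Real.ball_eq_Ioo]
      exact ⟨by linarith [hs.1], hs.2.trans_le (min_le_right _ _)⟩
    · exact hl' ⟨hs.1, hs.2.trans_le (min_le_left _ _)⟩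
  have hcl : ∀ {k : ℤ} {F : Filter ℝ} [F.NeBot], F ≤ 𝓝 t → (∀ᶠ s in F, r s ∈ region Δ k) →
      ((k : ℝ) - 1 / 2) * Δ ≤ r t ∧ r t ≤ ((k : ℝ) + 1 / 2) * Δ := by
    intro k F _ hF hk
    have ht := (hr.tendsto t).mono_left hF
    exact ⟨ge_of_tendsto ht (hk.mono fun s hs => hs.1),
      le_of_tendsto ht (hk.mono fun s hs => hs.2.le)⟩
  have hi := hcl nhdsWithin_le_nhds hl
  have hj := hcl nhdsWithin_le_nhds hr'
  have hstep : ∀ {i j : ℤ}, i < j → r t ≤ ((i : ℝ) + 1 / 2) * Δ → ((j : ℝ) - 1 / 2) * Δ ≤ r t →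
      j = i + 1 ∧ r t = ((i : ℝ) + 1 / 2) * Δ := by
    intro i j hlt h1 h2
    have h3 := le_of_mul_le_mul_right (h2.trans h1) hΔ
    have h4 : (j : ℝ) ≤ ((i + 1 : ℤ) : ℝ) := by push_cast; linarith
    have h5 : j ≤ i + 1 := by exact_mod_cast h4
    have h6 : j = i + 1 := by omega
    refine ⟨h6, le_antisymm h1 (le_trans (le_of_eq ?_) h2)⟩
    rw [h6]
    push_cast
    ring
  rcases lt_or_gt_of_ne hij with hlt | hlt
  · obtain ⟨rfl, h2⟩ := hstep hlt hi.2 hj.1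
    exact ⟨i, h2, hleft, hright⟩
  · obtain ⟨rfl, h2⟩ := hstep hlt hj.2 hi.1
    exact ⟨j, h2, hright, hleft⟩

/-- Near a crossing time of the reference, an offset between the reference and the output is seen
by the quantizers. -/
theorem CrossesAt.exists_abs_ge {Δ : ℝ} (hΔ : 0 < Δ) {r : ℝ → ℝ} (hr : Continuous r) {t : ℝ}
    (h : CrossesAt Δ r t) {D : ℝ} (hD : 0 ≤ D) {c : ℝ} (hc : c ≠ 0) {ε : ℝ} (hε : 0 < ε) :
    ∃ κ > 0, ∃ a b, a < b ∧ Set.Ioo a b ⊆ Metric.ball t ε ∧ ∀ s ∈ Set.Ioo a b, ∀ y v ζ : ℝ,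
      v ∈ filledQuantizer Δ y → r s - y = ζ - D * (quantizer Δ (r s) - v) →
      |ζ - c| ≤ |c| / 2 → κ ≤ |quantizer Δ (r s) - v| := by
  obtain ⟨i, hi, hlow, hup⟩ := h.exists_level hΔ hr
  have hc' : 0 < |c| := abs_pos.2 hc
  obtain ⟨δ, hδ, hδr⟩ := Metric.continuous_iff.1 hr t (|c| / 4) (by positivity)
  -- If `|u|` were below this `κ`, the direct term `D u` would be at most `|c| / 4`; together with
  -- `|r s - r t| < |c| / 4` it could not use up the offset, which is at least `|c| / 2`. And `|u| <
  -- Δ` excludes quantized values a step apart.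
  refine ⟨min Δ (|c| / (4 * (D + 1))), lt_min hΔ (by positivity), ?_⟩
  have hDw : ∀ w : ℝ, |w| < min Δ (|c| / (4 * (D + 1))) → |D * w| ≤ |c| / 4 ∧ |w| < Δ := by
    intro w hw
    obtain ⟨h1, h2⟩ := lt_min_iff.1 hw
    refine ⟨?_, h1⟩
    rw [abs_mul, abs_of_nonneg hD]
    calc D * |w| ≤ (D + 1) * (|c| / (4 * (D + 1))) := by gcongr; linarith
      _ = |c| / 4 := by field_simp
  rcases lt_or_gt_of_ne hc with hneg | hpos
  · obtain ⟨a, b, hab, hsub, hreg⟩ := hlow (min ε δ) (lt_min hε hδ)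
    refine ⟨a, b, hab, fun s hs => Metric.ball_subset_ball (min_le_left _ _) (hsub hs),
      fun s hs y v ζ hv he hζ => ?_⟩
    by_contra hlt
    obtain ⟨h1, h2⟩ := hDw _ (not_le.1 hlt)
    have h3 := hδr s (Metric.ball_subset_ball (min_le_right _ _) (hsub hs))
    rw [Real.dist_eq, hi, abs_of_neg hneg] at h3
    rw [abs_of_neg hneg] at h1 hζ
    have h4 := abs_lt.1 h3
    have h5 := abs_le.1 h1
    have h6 := abs_le.1 hζ
    have hy : ((i : ℝ) + 1 / 2) * Δ < y := by linarith
    have hq := quantizer_eq_of_mem_region hΔ (hreg s hs)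
    have hz := quantizer_le_filledQuantizer hΔ hy hv
    have hq2 : quantizer Δ (((i : ℝ) + 1 / 2) * Δ) = ((i + 1 : ℤ) : ℝ) * Δ := by
      refine quantizer_eq_of_mem_region hΔ ⟨le_of_eq ?_, ?_⟩
      · push_cast; ring
      · push_cast; linarith
    rw [hq2] at hz
    rw [hq] at h2
    have h7 := abs_lt.1 h2
    push_cast at hz
    linarith
  · obtain ⟨a, b, hab, hsub, hreg⟩ := hup (min ε δ) (lt_min hε hδ)
    refine ⟨a, b, hab, fun s hs => Metric.ball_subset_ball (min_le_left _ _) (hsub hs),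
      fun s hs y v ζ hv he hζ => ?_⟩
    by_contra hlt
    obtain ⟨h1, h2⟩ := hDw _ (not_le.1 hlt)
    have h3 := hδr s (Metric.ball_subset_ball (min_le_right _ _) (hsub hs))
    rw [Real.dist_eq, hi, abs_of_pos hpos] at h3
    rw [abs_of_pos hpos] at h1 hζ
    have h4 := abs_lt.1 h3
    have h5 := abs_le.1 h1
    have h6 := abs_le.1 hζ
    have hy : y < ((i : ℝ) + 1 / 2) * Δ := by linarith
    have hq := quantizer_eq_of_mem_region hΔ (hreg s hs)
    have hz : v ≤ i * Δ := by
      refine hv.2.trans (mul_le_mul_of_nonneg_right ?_ hΔ.le)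
      have : ⌊y / Δ + 1 / 2⌋ < i + 1 := by
        rw [Int.floor_lt]
        rw [← div_lt_iff₀ hΔ] at hy
        push_cast
        linarith
      exact_mod_cast Int.lt_add_one_iff.1 this
    rw [hq] at h2
    have h7 := abs_lt.1 h2
    push_cast at h7
    linarith

end Quantizer

/-! ### Coercivity of the storage and its decrease along solutions -/

section Energy

variable {n : ℕ}

/-- Compactness of the unit sphere; the sphere is empty when `n = 0`, which is treated apart. -/
theorem exists_pos_mul_norm_sq_le (β : LinearMap.BilinForm ℝ (Fin n → ℝ))
    (hβ : ∀ x, x ≠ 0 → 0 < β x x) : ∃ c > 0, ∀ x, c * ‖x‖ ^ 2 ≤ β x x := by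
  let L : (Fin n → ℝ) →L[ℝ] (Fin n → ℝ) →L[ℝ] ℝ := LinearMap.toContinuousLinearMap
    ((LinearMap.toContinuousLinearMap : ((Fin n → ℝ) →ₗ[ℝ] ℝ) ≃ₗ[ℝ] _).toLinearMap ∘ₗ β)
  have hL : ∀ x y, L x y = β x y := fun x y => rfl
  rcases (Metric.sphere (0 : Fin n → ℝ) 1).eq_empty_or_nonempty with hs | hs
  · refine ⟨1, one_pos, fun x => ?_⟩
    have hx : x = 0 := by
      by_contra hx
      have : ‖x‖⁻¹ • x ∈ Metric.sphere (0 : Fin n → ℝ) 1 := by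
        simp [norm_smul, norm_ne_zero_iff.2 hx]
      rw [hs] at this
      exact this
    simp [hx]
  · obtain ⟨x₀, hx₀, hmin⟩ := (isCompact_sphere (0 : Fin n → ℝ) 1).exists_isMinOn hs
      (f := fun x => L x x) (by fun_prop)
    have hx0 : x₀ ≠ 0 := by
      rintro rfl
      simp at hx₀
    refine ⟨β x₀ x₀, hβ _ hx0, fun x => ?_⟩
    rcases eq_or_ne x 0 with rfl | hx
    · simp
    · have hxn : 0 < ‖x‖ := norm_pos_iff.2 hx
      have : ‖x‖⁻¹ • x ∈ Metric.sphere (0 : Fin n → ℝ) 1 := by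
        simp [norm_smul, hxn.ne']
      have h1 : L x₀ x₀ ≤ L (‖x‖⁻¹ • x) (‖x‖⁻¹ • x) := hmin this
      simp only [map_smul, _root_.smul_apply, smul_eq_mul, hL] at h1
      calc β x₀ x₀ * ‖x‖ ^ 2 ≤ (‖x‖⁻¹ * (‖x‖⁻¹ * β x x)) * ‖x‖ ^ 2 := by gcongr
        _ = β x x := by field_simp

theorem AbsolutelyContinuousOnInterval.finset_sum {ι : Type*} (s : Finset ι) {f : ι → ℝ → ℝ}
    {a b : ℝ} (hf : ∀ i ∈ s, AbsolutelyContinuousOnInterval (f i) a b) :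
    AbsolutelyContinuousOnInterval (fun x => ∑ i ∈ s, f i x) a b := by
  classical
  induction s using Finset.induction_on with
  | empty =>
    simp only [Finset.sum_empty]
    exact (LipschitzWith.const (0 : ℝ)).lipschitzOnWith.absolutelyContinuousOnInterval
  | insert i s hi ih =>
    simp only [Finset.sum_insert hi]
    exact (hf i (Finset.mem_insert_self _ _)).add
      (ih fun j hj => hf j (Finset.mem_insert_of_mem hj))

/-- A storage function decreases along solutions by at least the extracted energy. -/
theorem storage_le (β : LinearMap.BilinForm ℝ (Fin n → ℝ)) (hsymm : ∀ x y, β x y = β y x)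
    {f ξ : ℝ → Fin n → ℝ} {p : ℝ → ℝ} {t : ℝ} (ht : 0 ≤ t)
    (hf : IntervalIntegrable f volume 0 t) (hp : IntervalIntegrable p volume 0 t)
    (hξ : ∀ s ∈ Set.Icc 0 t, ξ s = ξ 0 + ∫ τ in (0 : ℝ)..s, f τ)
    (hle : ∀ s ∈ Set.Icc 0 t, β (ξ s) (f s) ≤ -p s) :
    β (ξ t) (ξ t) + 2 * ∫ s in (0 : ℝ)..t, p s ≤ β (ξ 0) (ξ 0) := by
  let L : (Fin n → ℝ) →L[ℝ] (Fin n → ℝ) →L[ℝ] ℝ := LinearMap.toContinuousLinearMap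
    ((LinearMap.toContinuousLinearMap : ((Fin n → ℝ) →ₗ[ℝ] ℝ) ≃ₗ[ℝ] _).toLinearMap ∘ₗ β)
  let η : ℝ → Fin n → ℝ := fun s => ξ 0 + ∫ τ in (0 : ℝ)..s, f τ
  have hη : ∀ s ∈ Set.Icc 0 t, η s = ξ s := fun s hs => (hξ s hs).symm
  have hfi : ∀ i, IntervalIntegrable (fun s => f s i) volume 0 t := fun i =>
    ⟨hf.1.eval i, hf.2.eval i⟩
  have hηi : ∀ i, ∀ s ∈ Set.uIcc 0 t, η s i = ξ 0 i + ∫ τ in (0 : ℝ)..s, f τ i := by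
    intro i s hs
    have hfs : IntervalIntegrable f volume 0 s :=
      hf.mono_set (Set.uIcc_subset_uIcc_left hs)
    have := (ContinuousLinearMap.proj (R := ℝ) (φ := fun _ : Fin n => ℝ) i).intervalIntegral_comp_comm hfs
    simp only [ContinuousLinearMap.proj_apply] at this
    simp only [η, Pi.add_apply, this]
  let ηc : Fin n → ℝ → ℝ := fun i s => ξ 0 i + ∫ τ in (0 : ℝ)..s, f τ i
  have hac : ∀ i, AbsolutelyContinuousOnInterval (ηc i) 0 t := fun i =>
    ((LipschitzWith.const (ξ 0 i)).lipschitzOnWith.absolutelyContinuousOnInterval).add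
      ((hfi i).absolutelyContinuousOnInterval_intervalIntegral Set.left_mem_uIcc)
  let F : ℝ → ℝ := fun s => β (fun i => ηc i s) (fun i => ηc i s)
  -- The input is merely integrable, so the state has a derivative only almost everywhere. In
  -- coordinates the storage is a finite sum of products of absolutely continuous functions, and the
  -- fundamental theorem of calculus still applies.
  have hFsum : F = fun s => ∑ i, ∑ j,
      β (fun k => if i = k then 1 else 0) (fun k => if j = k then 1 else 0)
        * (ηc i s * ηc j s) := by
    ext s
    simp only [F]
    rw [LinearMap.pi_apply_eq_sum_univ β, LinearMap.sum_apply]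
    refine Finset.sum_congr rfl fun i _ => ?_
    rw [LinearMap.smul_apply, LinearMap.pi_apply_eq_sum_univ (β _), Finset.smul_sum]
    refine Finset.sum_congr rfl fun j _ => ?_
    simp only [smul_eq_mul]
    ring
  have hFac : AbsolutelyContinuousOnInterval F 0 t := by
    rw [hFsum]
    exact AbsolutelyContinuousOnInterval.finset_sum _ fun i _ =>
      AbsolutelyContinuousOnInterval.finset_sum _ fun j _ =>
        ((hac i).fun_mul (hac j)).const_mul _
  have hηF : ∀ s ∈ Set.Icc 0 t, (fun i => ηc i s) = ξ s := by
    intro s hs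
    rw [← hη s hs]
    ext i
    exact (hηi i s (by rwa [Set.uIcc_of_le ht])).symm
  have hderiv : ∀ᵐ s, s ∈ Set.uIcc 0 t → HasDerivAt F (2 * β (ξ s) (f s)) s := by
    have hall : ∀ᵐ s, ∀ i, s ∈ Set.uIcc 0 t → HasDerivAt (ηc i) (f s i) s := by
      rw [ae_all_iff]
      intro i
      filter_upwards [(hfi i).ae_hasDerivAt_integral] with s hs hst
      exact (hs hst 0 Set.left_mem_uIcc).const_add _
    filter_upwards [hall] with s hs hst
    have h1 : HasDerivAt (fun s i => ηc i s) (f s) s := hasDerivAt_pi.2 fun i => hs i hst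
    have h2 : HasDerivAt (fun s => L (fun i => ηc i s)) (L (f s)) s :=
      L.hasFDerivAt.comp_hasDerivAt s h1
    have h3 := h2.clm_apply h1
    have h4 : (fun i => ηc i s) = ξ s := hηF s (by rwa [Set.uIcc_of_le ht] at hst)
    rw [h4] at h3
    refine h3.congr_deriv ?_
    change β (f s) (ξ s) + β (ξ s) (f s) = _
    rw [hsymm (f s)]
    ring
  have hint := hFac.integral_deriv_eq_sub
  have hmono : ∫ s in (0 : ℝ)..t, deriv F s ≤ ∫ s in (0 : ℝ)..t, -2 * p s := by
    refine intervalIntegral.integral_mono_ae_restrict ht hFac.intervalIntegrable_deriv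
      (hp.const_mul _) ?_
    rw [EventuallyLE, ae_restrict_iff' measurableSet_Icc]
    filter_upwards [hderiv] with s hs hst
    rw [(hs (by rwa [Set.uIcc_of_le ht])).deriv]
    linarith [hle s hst]
  rw [hint, intervalIntegral.integral_const_mul] at hmono
  have e1 : F t = β (ξ t) (ξ t) := by simp only [F, hηF t ⟨ht, le_rfl⟩]
  have e0 : F 0 = β (ξ 0) (ξ 0) := by simp only [F, hηF 0 ⟨le_rfl, ht⟩]
  rw [e1, e0] at hmono
  linarith

end Energy

/-! ### Analyticity of the reference -/

section Reference

variable {m : ℕ} {δ₀ a₀ : ℝ} {a ω θ : Fin m → ℝ}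

theorem analyticOnNhd_reference : AnalyticOnNhd ℝ (reference δ₀ a₀ a ω θ) Set.univ := by
  intro t _
  unfold reference
  refine analyticAt_const.add ?_
  refine Finset.analyticAt_fun_sum _ fun i _ => analyticAt_const.mul ?_
  exact Real.analyticAt_sin.comp (by fun_prop)

theorem continuous_reference : Continuous (reference δ₀ a₀ a ω θ) := by
  unfold reference
  fun_prop

/-- The level sets of a nonconstant analytic function on the line are discrete, hence null. -/
theorem ae_ne_of_analyticOnNhd {f : ℝ → ℝ} (hf : AnalyticOnNhd ℝ f Set.univ)
    (hne : ∀ c, ∃ x, f x ≠ c) (c : ℝ) : ∀ᵐ t, f t ≠ c := by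
  obtain ⟨x, hx⟩ := hne c
  have h := (hf.sub analyticOnNhd_const (g := fun _ => c)).preimage_zero_mem_codiscrete (x := x)
    (by simpa [sub_eq_zero] using hx)
  have h2 := ae_restrict_le_codiscreteWithin (μ := (volume : Measure ℝ)) MeasurableSet.univ h
  rw [Measure.restrict_univ] at h2
  filter_upwards [h2] with t ht
  simpa [sub_eq_zero] using ht

theorem ae_levelDist_pos {Δ : ℝ} (hΔ : 0 < Δ) {f : ℝ → ℝ} (hf : AnalyticOnNhd ℝ f Set.univ)
    (hne : ∀ c, ∃ x, f x ≠ c) : ∀ᵐ t, 0 < levelDist Δ (f t) := by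
  have : ∀ᵐ t, ∀ j : ℤ, f t ≠ ((j : ℝ) + 1 / 2) * Δ := by
    rw [ae_all_iff]
    exact fun j => ae_ne_of_analyticOnNhd hf hne _
  filter_upwards [this] with t ht
  refine lt_of_le_of_ne (levelDist_nonneg hΔ _) fun h0 => ?_
  obtain ⟨j, hj⟩ := exists_level_of_levelDist_eq_zero hΔ h0.symm
  exact ht j hj

theorem CrossesAt.exists_ne {Δ : ℝ} (hΔ : 0 < Δ) {r : ℝ → ℝ} {t : ℝ} (h : CrossesAt Δ r t) (c : ℝ) :
    ∃ x, r x ≠ c := by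
  obtain ⟨i, j, hij, hi, hj⟩ := h
  obtain ⟨x, hx⟩ := hi.exists
  obtain ⟨y, hy⟩ := hj.exists
  by_contra! hall
  have h1 := quantizer_eq_of_mem_region hΔ hx
  have h2 := quantizer_eq_of_mem_region hΔ hy
  rw [hall] at h1 h2
  have := mul_right_cancel₀ hΔ.ne' (h1.symm.trans h2)
  exact hij (by exact_mod_cast this)

end Reference

/-! ### Decay of the mean quantized error -/

section Window

theorem intervalIntegrable_of_nonneg {E : Type*} [NormedAddCommGroup E] {f : ℝ → E}
    (h : ∀ t : ℝ, 0 ≤ t → IntervalIntegrable f volume 0 t) {a b : ℝ} (ha : 0 ≤ a) (hb : 0 ≤ b) :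
    IntervalIntegrable f volume a b :=
  (h a ha).symm.trans (h b hb)

/-- Each period is split by the size of `δ`. Where `δ ≥ 1 / (j + 1)`, `|u|` is at most `(j + 1) p`,
whose integral over the `k`-th period tends to `0`. Elsewhere `|u| ≤ M`, on a set whose measure does
not depend on `k` and is small for large `j`. So `j` is fixed before `k`. -/
theorem tendsto_integral_abs_window {δ p u : ℝ → ℝ} {T M K : ℝ} (hT : 0 < T)
    (hδ : Function.Periodic δ T) (hδm : Measurable δ) (hδpos : ∀ᵐ t, 0 < δ t)
    (hu : ∀ t : ℝ, 0 ≤ t → IntervalIntegrable u volume 0 t)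
    (hp : ∀ t : ℝ, 0 ≤ t → IntervalIntegrable p volume 0 t) (hp0 : ∀ t, 0 ≤ t → 0 ≤ p t)
    (hpK : ∀ t, 0 ≤ t → ∫ s in (0 : ℝ)..t, p s ≤ K) (hM : ∀ t, 0 ≤ t → |u t| ≤ M)
    (hle : ∀ t, 0 ≤ t → δ t * |u t| ≤ p t) :
    Tendsto (fun k : ℕ => ∫ s in (k * T : ℝ)..(k * T + T), |u s|) atTop (𝓝 0) := by
  have hM0 : 0 ≤ M := (abs_nonneg _).trans (hM 0 le_rfl)
  have hkT : ∀ k : ℕ, (0 : ℝ) ≤ k * T := fun k => by positivity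
  -- the extracted energy in the `k`-th period tends to zero
  have hb : Tendsto (fun k : ℕ => ∫ s in (k * T : ℝ)..(k * T + T), p s) atTop (𝓝 0) := by
    let I : ℕ → ℝ := fun k => ∫ s in (0 : ℝ)..(k * T), p s
    have hdiff : ∀ k : ℕ, ∫ s in (k * T : ℝ)..(k * T + T), p s = I (k + 1) - I k := by
      intro k
      have e : ((k + 1 : ℕ) : ℝ) * T = k * T + T := by push_cast; ring
      simp only [I, e]
      rw [intervalIntegral.integral_interval_sub_left (hp _ (by linarith [hkT k])) (hp _ (hkT k))]
    have hmono : Monotone I := monotone_nat_of_le_succ fun k => by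
      have : 0 ≤ ∫ s in (k * T : ℝ)..(k * T + T), p s :=
        intervalIntegral.integral_nonneg (by linarith) fun s hs => hp0 s ((hkT k).trans hs.1)
      linarith [hdiff k]
    have hlim := tendsto_atTop_ciSup hmono ⟨K, by rintro _ ⟨k, rfl⟩; exact hpK _ (hkT k)⟩
    simp only [hdiff]
    simpa using (hlim.comp (tendsto_add_atTop_nat 1)).sub hlim
  -- the set where `δ` is small has small measure
  let ind : ℕ → ℝ → ℝ := fun j t => if δ t < 1 / ((j : ℝ) + 1) then 1 else 0
  have hindm : ∀ j, Measurable (ind j) := fun j =>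
    Measurable.ite (measurableSet_lt hδm measurable_const) measurable_const measurable_const
  have hind1 : ∀ j t, |ind j t| ≤ 1 := by
    intro j t
    simp only [ind]
    split_ifs <;> simp
  have hindi : ∀ j a b, IntervalIntegrable (ind j) volume a b := by
    intro j a b
    refine (intervalIntegrable_const (c := (1 : ℝ))).mono_fun
      (hindm j).aestronglyMeasurable (ae_of_all _ fun t => ?_)
    simpa using hind1 j t
  have hG : Tendsto (fun j => ∫ s in (0 : ℝ)..T, ind j s) atTop (𝓝 0) := by
    suffices h : Tendsto (fun j => ∫ s in (0 : ℝ)..T, ind j s) atTop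
        (𝓝 (∫ _ in (0 : ℝ)..T, (0 : ℝ))) by simpa using h
    refine intervalIntegral.tendsto_integral_filter_of_dominated_convergence (fun _ => 1)
      (Eventually.of_forall fun j => (hindm j).aestronglyMeasurable)
      (Eventually.of_forall fun j => ae_of_all _ fun t _ => hind1 j t)
      intervalIntegrable_const ?_
    filter_upwards [hδpos] with t ht _
    obtain ⟨N, hN⟩ := exists_nat_one_div_lt ht
    refine tendsto_const_nhds.congr' ?_
    filter_upwards [eventually_ge_atTop N] with j hj
    have : ¬ δ t < 1 / ((j : ℝ) + 1) := by
      have := one_div_le_one_div_of_le (by positivity : (0 : ℝ) < N + 1)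
        (by gcongr : (N : ℝ) + 1 ≤ j + 1)
      linarith
    exact (if_neg this).symm
  have hper : ∀ j k : ℕ, ∫ s in (k * T : ℝ)..(k * T + T), ind j s = ∫ s in (0 : ℝ)..T, ind j s := by
    intro j k
    have h1 : Function.Periodic (ind j) T := fun t => by simp only [ind, hδ t]
    simpa using h1.intervalIntegral_add_eq (k * T) 0
  have hbound : ∀ j k : ℕ, ∫ s in (k * T : ℝ)..(k * T + T), |u s|
      ≤ ((j : ℝ) + 1) * (∫ s in (k * T : ℝ)..(k * T + T), p s)
        + M * ∫ s in (0 : ℝ)..T, ind j s := by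
    intro j k
    have hk1 : (0 : ℝ) ≤ k * T + T := by linarith [hkT k]
    have hpi := intervalIntegrable_of_nonneg hp (hkT k) hk1
    have hui := intervalIntegrable_of_nonneg hu (hkT k) hk1
    rw [← hper j k, ← intervalIntegral.integral_const_mul, ← intervalIntegral.integral_const_mul,
      ← intervalIntegral.integral_add (hpi.const_mul _) ((hindi j _ _).const_mul _)]
    refine intervalIntegral.integral_mono_on (by linarith) hui.abs
      ((hpi.const_mul _).add ((hindi j _ _).const_mul _)) fun s hs => ?_
    have hs0 : 0 ≤ s := (hkT k).trans hs.1
    by_cases hsmall : δ s < 1 / ((j : ℝ) + 1)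
    · have : ind j s = 1 := if_pos hsmall
      rw [this, mul_one]
      have := mul_nonneg (by positivity : (0 : ℝ) ≤ (j : ℝ) + 1) (hp0 s hs0)
      linarith [hM s hs0]
    · have : ind j s = 0 := if_neg hsmall
      rw [this, mul_zero, add_zero]
      have h1 := mul_le_mul_of_nonneg_right (not_lt.1 hsmall) (abs_nonneg (u s))
      have h2 := h1.trans (hle s hs0)
      rwa [one_div, inv_mul_le_iff₀ (by positivity)] at h2
  rw [Metric.tendsto_atTop]
  intro ε hε
  have hGM : Tendsto (fun j => M * ∫ s in (0 : ℝ)..T, ind j s) atTop (𝓝 0) := by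
    simpa using hG.const_mul M
  obtain ⟨j, hj⟩ := (hGM.eventually (gt_mem_nhds (half_pos hε))).exists
  have hbj : Tendsto (fun k : ℕ => ((j : ℝ) + 1) * ∫ s in (k * T : ℝ)..(k * T + T), p s)
      atTop (𝓝 0) := by
    simpa using hb.const_mul ((j : ℝ) + 1)
  obtain ⟨N, hN⟩ := eventually_atTop.1 (hbj.eventually (gt_mem_nhds (half_pos hε)))
  refine ⟨N, fun k hk => ?_⟩
  have hnn : 0 ≤ ∫ s in (k * T : ℝ)..(k * T + T), |u s| :=
    intervalIntegral.integral_nonneg (by linarith) fun s _ => abs_nonneg _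
  rw [Real.dist_eq, sub_zero, abs_of_nonneg hnn]
  linarith [hbound j k, hN k hk]

end Window

/-! ### The linear flow and its perturbation by small inputs -/

section Flow

variable {n : ℕ}

/-- The flow `exp (s A)` of the linear system `ẋ = A x`. -/
noncomputable def flow (A : Matrix (Fin n) (Fin n) ℝ) (s : ℝ) : (Fin n → ℝ) →L[ℝ] (Fin n → ℝ) :=
  NormedSpace.exp (s • A.mulVecLin.toContinuousLinearMap)

variable (A : Matrix (Fin n) (Fin n) ℝ)

theorem flow_zero : flow A 0 = 1 := by simp [flow]

theorem flow_add (s t : ℝ) : flow A (s + t) = flow A s * flow A t := by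
  let : NormedAlgebra ℚ ((Fin n → ℝ) →L[ℝ] (Fin n → ℝ)) := NormedAlgebra.restrictScalars ℚ ℝ _
  rw [flow, add_smul]
  exact NormedSpace.exp_add_of_commute (((Commute.refl _).smul_left s).smul_right t)

theorem hasDerivAt_flow (s : ℝ) :
    HasDerivAt (flow A) (A.mulVecLin.toContinuousLinearMap * flow A s) s := by
  unfold flow
  exact hasDerivAt_exp_smul_const' (𝔸 := (Fin n → ℝ) →L[ℝ] (Fin n → ℝ)) _ s

theorem flow_mulVec (s : ℝ) (v : Fin n → ℝ) : flow A s (A *ᵥ v) = A *ᵥ flow A s v := by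
  have h := (hasDerivAt_exp_smul_const (A.mulVecLin.toContinuousLinearMap) s).unique
    (hasDerivAt_exp_smul_const' _ s)
  exact congrArg (fun L => L v) h

theorem hasDerivAt_flow_apply (v : Fin n → ℝ) (s : ℝ) :
    HasDerivAt (fun s => flow A s v) (A *ᵥ flow A s v) s := by
  have := (hasDerivAt_flow A s).clm_apply (hasDerivAt_const s v)
  simpa using this

theorem continuous_flow : Continuous (flow A) :=
  continuous_iff_continuousAt.2 fun s => (hasDerivAt_flow A s).continuousAt

theorem flow_neg_apply_flow (s : ℝ) (v : Fin n → ℝ) : flow A (-s) (flow A s v) = v := by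
  have := flow_add A (-s) s
  rw [neg_add_cancel, flow_zero] at this
  exact (congrArg (fun L => L v) this).symm

theorem flow_apply_flow_neg (s : ℝ) (v : Fin n → ℝ) : flow A s (flow A (-s) v) = v := by
  simpa using flow_neg_apply_flow A (-s) v

theorem flow_add_apply (s t : ℝ) (v : Fin n → ℝ) : flow A (s + t) v = flow A s (flow A t v) := by
  rw [flow_add]
  rfl

theorem exists_norm_flow_le (L : ℝ) : ∃ M, 0 ≤ M ∧ ∀ s, |s| ≤ L → ‖flow A s‖ ≤ M := by
  obtain ⟨M, hM⟩ := (isCompact_Icc (a := -L) (b := L)).exists_bound_of_continuousOn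
    (continuous_flow A).continuousOn
  exact ⟨max M 0, le_max_right _ _, fun s hs => (hM s (abs_le.1 hs)).trans (le_max_left _ _)⟩

/-- A solution driven by a small input is close to the free motion. -/
theorem exists_norm_sub_flow_le (B : Fin n → ℝ) {L : ℝ} (hL : 0 ≤ L) : ∃ K, 0 ≤ K ∧
    ∀ (ξ : ℝ → Fin n → ℝ) (u : ℝ → ℝ), ContinuousOn ξ (Set.Ici 0) →
      (∀ t : ℝ, 0 ≤ t → IntervalIntegrable u volume 0 t) →
      (∀ t : ℝ, 0 ≤ t → ξ t = ξ 0 + ∫ s in (0 : ℝ)..t, (A *ᵥ ξ s - u s • B)) →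
      ∀ t₀, 0 ≤ t₀ → ∀ s ∈ Set.Icc 0 L,
        ‖ξ (t₀ + s) - flow A s (ξ t₀)‖ ≤ K * ∫ τ in t₀..(t₀ + L), |u τ| := by
  obtain ⟨M, hM0, hM⟩ := exists_norm_flow_le A L
  refine ⟨M * (M * ‖A *ᵥ B‖ * L) + ‖B‖, by positivity, fun ξ u hξ hu heq t₀ ht₀ s hs => ?_⟩
  set I := ∫ τ in t₀..(t₀ + L), |u τ| with hI
  let ν : ℝ → ℝ := fun s => ∫ τ in t₀..(t₀ + s), u τ
  have hui : ∀ s, 0 ≤ s → IntervalIntegrable u volume t₀ (t₀ + s) := fun s hs =>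
    intervalIntegrable_of_nonneg hu ht₀ (by linarith)
  have hν : ∀ s ∈ Set.Icc 0 L, |ν s| ≤ I := by
    intro s hs
    calc |ν s| ≤ ∫ τ in t₀..(t₀ + s), |u τ| :=
          intervalIntegral.abs_integral_le_integral_abs (by linarith [hs.1])
      _ ≤ I := by
          refine intervalIntegral.integral_mono_interval le_rfl (by linarith [hs.1])
            (by linarith [hs.2]) (ae_of_all _ fun τ => abs_nonneg _) (hui L hL).abs
  -- Freezing the state before time `0` gives a function continuous on the whole line, so that its
  -- integral has two-sided derivatives at the endpoint as well.
  let ξh : ℝ → Fin n → ℝ := fun s => ξ (t₀ + max s 0)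
  have hξh : Continuous ξh := by
    refine hξ.comp_continuous (by fun_prop) fun s => ?_
    have := le_max_right s 0
    simp only [Set.mem_Ici]
    linarith
  have hAξh : Continuous fun s => A *ᵥ ξh s := by fun_prop
  let w : ℝ → Fin n → ℝ := fun s => ξ t₀ + ∫ τ in (0 : ℝ)..s, A *ᵥ ξh τ
  have hw' : ∀ s, HasDerivAt w (A *ᵥ ξh s) s := fun s =>
    (hAξh.integral_hasStrictDerivAt 0 s).hasDerivAt.const_add _
  have hAξi : ∀ t, 0 ≤ t → IntervalIntegrable (fun s => A *ᵥ ξ s) volume 0 t := by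
    intro t ht
    have hc : ContinuousOn (fun s => A *ᵥ ξ s) (Set.Ici 0) :=
      (A.mulVecLin.toContinuousLinearMap.continuous.comp_continuousOn hξ)
    refine (hc.mono ?_).intervalIntegrable
    rw [Set.uIcc_of_le ht]
    exact fun x hx => hx.1
  have huB : ∀ t, 0 ≤ t → IntervalIntegrable (fun s => u s • B) volume 0 t := fun t ht =>
    ⟨(hu t ht).1.smul_const B, (hu t ht).2.smul_const B⟩
  have hw : ∀ s ∈ Set.Icc 0 L, w s = ξ (t₀ + s) + ν s • B := by
    intro s hs
    have hts : 0 ≤ t₀ + s := by linarith [hs.1]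
    have e1 : ∫ τ in (0 : ℝ)..s, A *ᵥ ξh τ = ∫ τ in t₀..(t₀ + s), A *ᵥ ξ τ := by
      have h1 := intervalIntegral.integral_comp_add_left (a := 0) (b := s)
        (fun τ => A *ᵥ ξ τ) t₀
      rw [add_zero] at h1
      rw [← h1]
      refine intervalIntegral.integral_congr fun τ hτ => ?_
      rw [Set.uIcc_of_le hs.1] at hτ
      simp only [ξh, max_eq_left hτ.1]
    have e2 : ξ (t₀ + s) - ξ t₀ = ∫ τ in t₀..(t₀ + s), (A *ᵥ ξ τ - u τ • B) := by
      rw [heq _ hts, heq _ ht₀, add_sub_add_left_eq_sub]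
      exact intervalIntegral.integral_interval_sub_left ((hAξi _ hts).sub (huB _ hts))
        ((hAξi _ ht₀).sub (huB _ ht₀))
    rw [intervalIntegral.integral_sub (intervalIntegrable_of_nonneg hAξi ht₀ hts)
      (intervalIntegrable_of_nonneg huB ht₀ hts), intervalIntegral.integral_smul_const] at e2
    simp only [w, ν, e1]
    rw [sub_eq_iff_eq_add] at e2
    rw [e2]
    abel
  -- `w = ξ + ν B` absorbs the rough input and is continuously differentiable. Pulled back by the
  -- flow, its derivative involves only `ν`, which the integral of `|u|` bounds.
  let φ : ℝ → Fin n → ℝ := fun s => flow A (-s) (w s)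
  have hφ' : ∀ s ∈ Set.Icc 0 L, HasDerivAt φ (-(ν s • flow A (-s) (A *ᵥ B))) s := by
    intro s hs
    have h1 : HasDerivAt (fun s => flow A (-s))
        (-(A.mulVecLin.toContinuousLinearMap * flow A (-s))) s := by
      have := (hasDerivAt_flow A (-s)).scomp s (hasDerivAt_neg s)
      rw [neg_one_smul] at this
      exact this
    have h2 := h1.clm_apply (hw' s)
    refine h2.congr_deriv ?_
    have h3 : ξh s = w s - ν s • B := by
      rw [hw s hs]
      simp [ξh, max_eq_left hs.1]
    rw [h3, Matrix.mulVec_sub, map_sub, Matrix.mulVec_smul, map_smul, flow_mulVec A (-s) (w s)]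
    change -(A *ᵥ flow A (-s) (w s)) + _ = _
    abel
  have hI0 : 0 ≤ I := (abs_nonneg _).trans (hν 0 ⟨le_rfl, hL⟩)
  have hφ := norm_image_sub_le_of_norm_deriv_le_segment' (f := φ) (a := 0) (b := L)
    (f' := fun s => -(ν s • flow A (-s) (A *ᵥ B))) (C := I * (M * ‖A *ᵥ B‖))
    (fun s hs => (hφ' s hs).hasDerivWithinAt) (fun s hs => by
      have hs' : s ∈ Set.Icc 0 L := ⟨hs.1, hs.2.le⟩
      rw [norm_neg, norm_smul, Real.norm_eq_abs]
      refine mul_le_mul (hν s hs') ((flow A (-s)).le_of_opNorm_le (hM _ ?_) _) (norm_nonneg _) hI0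
      rw [abs_neg, abs_of_nonneg hs.1]
      exact hs.2.le) s hs
  have hφ0 : φ 0 = ξ t₀ := by simp [φ, w, flow_zero]
  have hfin : ξ (t₀ + s) - flow A s (ξ t₀) = flow A s (φ s - φ 0) - ν s • B := by
    rw [map_sub, hφ0]
    simp only [φ]
    rw [flow_apply_flow_neg, hw s hs]
    abel
  rw [hfin]
  have hMs : ‖flow A s‖ ≤ M := hM s (by rw [abs_of_nonneg hs.1]; exact hs.2)
  calc ‖flow A s (φ s - φ 0) - ν s • B‖ ≤ ‖flow A s (φ s - φ 0)‖ + ‖ν s • B‖ := norm_sub_le _ _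
    _ ≤ M * (I * (M * ‖A *ᵥ B‖) * L) + I * ‖B‖ := by
        refine add_le_add ?_ ?_
        · refine (flow A s).le_of_opNorm_le_of_le hMs (hφ.trans ?_)
          rw [sub_zero]
          exact mul_le_mul_of_nonneg_left hs.2 (by positivity)
        · rw [norm_smul, Real.norm_eq_abs]
          exact mul_le_mul_of_nonneg_right (hν s hs) (norm_nonneg _)
    _ = _ := by ring

end Flow

/-! ### Bounded free motions and their modes -/

section Spectral

variable {n : ℕ}

/-- `G` is a bounded solution of `ẋ = A x` on the whole real line. -/
structure IsBoundedSolution (A : Matrix (Fin n) (Fin n) ℂ) (G : ℝ → Fin n → ℂ) : Prop where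
  hasDerivAt : ∀ s, HasDerivAt G (A *ᵥ G s) s
  bounded : ∃ M, ∀ s, ‖G s‖ ≤ M

theorem commute_aeval_self (A : Matrix (Fin n) (Fin n) ℂ) (q : Polynomial ℂ) :
    Commute (Polynomial.aeval A q) A := by
  have h := congrArg (Polynomial.aeval A) (mul_comm q Polynomial.X)
  rwa [map_mul, map_mul, Polynomial.aeval_X] at h

namespace IsBoundedSolution

variable {A : Matrix (Fin n) (Fin n) ℂ} {G : ℝ → Fin n → ℂ}

theorem mulVec (h : IsBoundedSolution A G) {P : Matrix (Fin n) (Fin n) ℂ} (hP : Commute P A) :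
    IsBoundedSolution A fun s => P *ᵥ G s := by
  refine ⟨fun s => ?_, ?_⟩
  · have := ((P.mulVecLin.toContinuousLinearMap).restrictScalars ℝ).hasFDerivAt.comp_hasDerivAt s
      (h.hasDerivAt s)
    refine this.congr_deriv ?_
    change P *ᵥ (A *ᵥ G s) = A *ᵥ (P *ᵥ G s)
    rw [Matrix.mulVec_mulVec, Matrix.mulVec_mulVec, hP.eq]
  · obtain ⟨M, hM⟩ := h.bounded
    exact ⟨‖P.mulVecLin.toContinuousLinearMap‖ * M, fun s =>
      (P.mulVecLin.toContinuousLinearMap).le_opNorm_of_le (hM s)⟩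

theorem eq_exp_smul (h : IsBoundedSolution A G) {l : ℂ} (hl : ∀ s, A *ᵥ G s = l • G s) (s : ℝ) :
    G s = Complex.exp (l * s) • G 0 := by
  have hexp : ∀ s : ℝ, HasDerivAt (fun s : ℝ => Complex.exp (-l * s))
      (-l * Complex.exp (-l * s)) s := by
    intro s
    have h1 : HasDerivAt (fun s : ℝ => -l * (s : ℂ)) (-l) s := by
      simpa using (Complex.ofRealCLM.hasDerivAt (x := s)).const_mul (-l)
    exact h1.cexp.congr_deriv (by ring)
  have hd : ∀ s : ℝ, HasDerivAt (fun s : ℝ => Complex.exp (-l * s) • G s) 0 s := by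
    intro s
    refine ((hexp s).smul (h.hasDerivAt s)).congr_deriv ?_
    rw [hl, smul_smul, ← add_smul]
    have : Complex.exp (-l * s) * l + -l * Complex.exp (-l * s) = 0 := by ring
    rw [this, zero_smul]
  have hc := is_const_of_deriv_eq_zero (fun s => (hd s).differentiableAt) (fun s => (hd s).deriv) s 0
  simp only [Complex.ofReal_zero, mul_zero, Complex.exp_zero, one_smul] at hc
  rw [← hc, smul_smul, ← Complex.exp_add]
  simp

/-- A decaying mode blows up as `s → -∞`. -/
theorem eq_zero_of_re_neg (h : IsBoundedSolution A G) {l : ℂ} (hre : l.re < 0)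
    (hl : ∀ s, A *ᵥ G s = l • G s) (s : ℝ) : G s = 0 := by
  obtain ⟨M, hM⟩ := h.bounded
  have hG0 : G 0 = 0 := by
    have hle : ∀ s : ℝ, ‖G 0‖ ≤ Real.exp (-(l.re * s)) * M := by
      intro s
      have h1 := congrArg norm (h.eq_exp_smul hl s)
      rw [norm_smul, Complex.norm_exp] at h1
      simp only [Complex.mul_re, Complex.ofReal_re, Complex.ofReal_im, mul_zero, sub_zero] at h1
      rw [Real.exp_neg, ← div_eq_inv_mul, le_div_iff₀' (Real.exp_pos _), ← h1]
      exact hM s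
    have hlim : Tendsto (fun s : ℝ => Real.exp (-(l.re * s)) * M) atBot (𝓝 (0 * M)) := by
      refine (Real.tendsto_exp_atBot.comp ?_).mul_const M
      rw [tendsto_neg_atBot_iff]
      exact tendsto_id.const_mul_atBot_of_neg hre
    rw [zero_mul] at hlim
    exact norm_le_zero_iff.1 (ge_of_tendsto' hlim hle)
  rw [h.eq_exp_smul hl, hG0, smul_zero]

/-- Stable factors are removed one at a time, with multiplicity: a polynomial in `A` applied to `G`
is again a bounded solution, and the factor `X - l` puts it in the eigenspace of `l`. -/
theorem aeval_eq_zero_of_re_neg (h : IsBoundedSolution A G) (q : Polynomial ℂ) (S : Multiset ℂ)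
    (hS : ∀ l ∈ S, l.re < 0)
    (h0 : ∀ s, Polynomial.aeval A ((S.map fun l => Polynomial.X - Polynomial.C l).prod * q) *ᵥ G s
      = 0) (s : ℝ) : Polynomial.aeval A q *ᵥ G s = 0 := by
  induction S using Multiset.induction_on generalizing s with
  | empty => simpa using h0 s
  | cons l S ih =>
    refine ih (fun l' hl' => hS l' (Multiset.mem_cons_of_mem hl')) (fun s => ?_) s
    set Q := (S.map fun l => Polynomial.X - Polynomial.C l).prod * q with hQ
    refine (h.mulVec (commute_aeval_self A Q)).eq_zero_of_re_neg (hS l (Multiset.mem_cons_self l S)) (fun s => ?_) s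
    have h1 := h0 s
    rw [Multiset.map_cons, Multiset.prod_cons, mul_assoc, ← hQ, map_mul, map_sub,
      Polynomial.aeval_X, Polynomial.aeval_C, ← Matrix.mulVec_mulVec, Matrix.sub_mulVec,
      sub_eq_zero] at h1
    rw [h1, Algebra.algebraMap_eq_smul_one, Matrix.smul_mulVec, Matrix.one_mulVec]

/-- For distinct roots the Lagrange basis polynomials evaluated at `A` act on `G` as spectral
projections. Simplicity of the imaginary poles enters here: no terms `s exp (l s)` arise. -/
theorem exists_eq_sum_exp (h : IsBoundedSolution A G) (I : Finset ℂ)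
    (h0 : ∀ s, Polynomial.aeval A (∏ l ∈ I, (Polynomial.X - Polynomial.C l)) *ᵥ G s = 0) :
    ∃ w : ℂ → Fin n → ℂ, ∀ s : ℝ, G s = ∑ l ∈ I, Complex.exp (l * s) • w l := by
  rcases I.eq_empty_or_nonempty with rfl | hI
  · exact ⟨fun _ => 0, fun s => by simpa using h0 s⟩
  refine ⟨fun l => Polynomial.aeval A (Lagrange.basis I id l) *ᵥ G 0, fun s => ?_⟩
  have hsum : G s = ∑ l ∈ I, Polynomial.aeval A (Lagrange.basis I id l) *ᵥ G s := by
    rw [← Matrix.sum_mulVec, ← map_sum, Lagrange.sum_basis Function.injective_id.injOn hI, map_one,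
      Matrix.one_mulVec]
  rw [hsum]
  refine Finset.sum_congr rfl fun l hl => ?_
  refine (h.mulVec (commute_aeval_self A _)).eq_exp_smul (l := l) (fun s => ?_) s
  have hprod : (Polynomial.X - Polynomial.C l) * Lagrange.basis I id l
      = Polynomial.C (∏ j ∈ I.erase l, (l - j)⁻¹) * ∏ j ∈ I, (Polynomial.X - Polynomial.C j) := by
    rw [Lagrange.basis, ← Finset.mul_prod_erase I _ hl, map_prod]
    simp only [Lagrange.basisDivisor, Finset.prod_mul_distrib, id]
    ring
  have h1 : Polynomial.aeval A ((Polynomial.X - Polynomial.C l) * Lagrange.basis I id l) *ᵥ G s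
      = 0 := by
    rw [hprod, map_mul, ← Matrix.mulVec_mulVec, h0, Matrix.mulVec_zero]
  rw [map_mul, map_sub, Polynomial.aeval_X, Polynomial.aeval_C, ← Matrix.mulVec_mulVec,
    Matrix.sub_mulVec, sub_eq_zero] at h1
  rw [h1, Algebra.algebraMap_eq_smul_one, Matrix.smul_mulVec, Matrix.one_mulVec]

end IsBoundedSolution

theorem exists_regressor_mode {m : ℕ} (ω : Fin m → ℝ) {l : ℂ}
    (hl : l = 0 ∨ ∃ i, l = Complex.I * (ω i : ℂ) ∨ l = -(Complex.I * (ω i : ℂ))) (c : ℂ) :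
    ∃ g : Unit ⊕ Fin m ⊕ Fin m → ℝ, ∀ s : ℝ,
      (Complex.exp (l * s) * c).re = ∑ j, regressor ω s j * g j := by
  have hmode : ∀ (i : Fin m) (w : ℝ), w = ω i ∨ w = -ω i → ∃ g : Unit ⊕ Fin m ⊕ Fin m → ℝ,
      ∀ s : ℝ, (Complex.exp (Complex.I * w * s) * c).re = ∑ j, regressor ω s j * g j := by
    intro i w hw
    have hre : ∀ s : ℝ, (Complex.exp (Complex.I * w * s) * c).re
        = c.re * Real.cos (w * s) - c.im * Real.sin (w * s) := by
      intro s
      have : Complex.I * w * s = ((w * s : ℝ) : ℂ) * Complex.I := by push_cast; ring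
      rw [this, Complex.mul_re, Complex.exp_ofReal_mul_I_re, Complex.exp_ofReal_mul_I_im]
      ring
    rcases hw with rfl | rfl
    · refine ⟨Pi.single (Sum.inr (Sum.inl i)) (-c.im) + Pi.single (Sum.inr (Sum.inr i)) c.re,
        fun s => ?_⟩
      rw [hre]
      simp only [Pi.add_apply, mul_add, Finset.sum_add_distrib, Pi.single_apply, mul_ite, mul_zero,
        Finset.sum_ite_eq', Finset.mem_univ, if_true, regressor]
      ring
    · refine ⟨Pi.single (Sum.inr (Sum.inl i)) c.im + Pi.single (Sum.inr (Sum.inr i)) c.re,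
        fun s => ?_⟩
      rw [hre, neg_mul, Real.cos_neg, Real.sin_neg]
      simp only [Pi.add_apply, mul_add, Finset.sum_add_distrib, Pi.single_apply, mul_ite, mul_zero,
        Finset.sum_ite_eq', Finset.mem_univ, if_true, regressor]
      ring
  rcases hl with rfl | ⟨i, rfl | rfl⟩
  · refine ⟨Pi.single (Sum.inl ()) c.re, fun s => ?_⟩
    simp only [Pi.single_apply, mul_ite, mul_zero,
        Finset.sum_ite_eq', Finset.mem_univ, if_true, regressor]
    simp
  · exact hmode i (ω i) (Or.inl rfl)
  · obtain ⟨g, hg⟩ := hmode i (-ω i) (Or.inr rfl)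
    refine ⟨g, fun s => ?_⟩
    rw [← hg]
    push_cast
    ring_nf

variable {A : Matrix (Fin n) (Fin n) ℝ} {B C : Fin n → ℝ} {D : ℝ} {H : RatFunc ℝ}

/-- The output of a free motion that stays bounded for all times is a combination of the
regressors. -/
theorem IsMinimalRealization.exists_output_eq_regressor (h : IsMinimalRealization H A B C D)
    {m : ℕ} {ω : Fin m → ℝ} {δ₀ : ℝ} (hpole_zero : δ₀ = 1 → IsSimplePole H 0)
    (hpole_freq : ∀ i, IsSimplePole H (Complex.I * (ω i : ℂ)) ∧
      IsSimplePole H (-(Complex.I * (ω i : ℂ))))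
    (hpole_other : ∀ s : ℂ, IsPole H s → ¬ (δ₀ = 1 ∧ s = 0) →
      (∀ i, s ≠ Complex.I * (ω i : ℂ) ∧ s ≠ -(Complex.I * (ω i : ℂ))) → s.re < 0)
    {v : Fin n → ℝ} {M : ℝ} (hv : ∀ s, ‖flow A s v‖ ≤ M) :
    ∃ g : Unit ⊕ Fin m ⊕ Fin m → ℝ, ∀ s : ℝ, C ⬝ᵥ flow A s v = ∑ j, regressor ω s j * g j := by
  classical
  let G : ℝ → Fin n → ℂ := fun s i => (flow A s v i : ℂ)
  set Ac := A.map (algebraMap ℝ ℂ) with hAc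
  have hG : IsBoundedSolution Ac G := by
    refine ⟨fun s => ?_, M, fun s => ?_⟩
    · rw [hasDerivAt_pi]
      intro i
      have h1 := (hasDerivAt_pi.1 (hasDerivAt_flow_apply A v s) i).ofReal_comp
      refine h1.congr_deriv ?_
      simp [hAc, G, Matrix.mulVec, dotProduct]
    · refine (pi_norm_le_iff_of_nonneg ((norm_nonneg _).trans (hv s))).2 fun i => ?_
      simp only [G, Complex.norm_real]
      exact (norm_le_pi_norm _ i).trans (hv s)
  set d := H.denom.map (algebraMap ℝ ℂ) with hd
  have hmonic : d.Monic := (RatFunc.monic_denom H).map _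
  have hsplit : d = (d.roots.map fun l => Polynomial.X - Polynomial.C l).prod :=
    (IsAlgClosed.splits d).eq_prod_roots_of_monic hmonic
  have hpole : ∀ l ∈ d.roots, IsPole H l := by
    intro l hl
    have h1 := Polynomial.isRoot_of_mem_roots hl
    rw [Polynomial.IsRoot, hd, Polynomial.eval_map] at h1
    exact isPole_iff.2 h1
  have himag : ∀ l ∈ d.roots, ¬ l.re < 0 →
      (δ₀ = 1 ∧ l = 0) ∨ ∃ i, l = Complex.I * (ω i : ℂ) ∨ l = -(Complex.I * (ω i : ℂ)) := by
    intro l hl hre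
    by_contra hcon
    push Not at hcon
    exact hre (hpole_other l (hpole l hl) (fun hh => hcon.1 hh.1 hh.2) hcon.2)
  have hcount : ∀ l ∈ d.roots, ¬ l.re < 0 → d.roots.count l = 1 := by
    intro l hl hre
    rw [Polynomial.count_roots]
    rcases himag l hl hre with ⟨h1, rfl⟩ | ⟨i, rfl | rfl⟩
    · exact hpole_zero h1
    · exact (hpole_freq i).1
    · exact (hpole_freq i).2
  -- `S` collects the stable poles, with multiplicity; the rest `N` lies among `0` and `± j ωᵢ`,
  -- without repetition, so it can be replaced by a finite set.
  set S := d.roots.filter fun l => l.re < 0 with hS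
  set N := d.roots.filter fun l => ¬ l.re < 0 with hN
  have hSN : S + N = d.roots := Multiset.filter_add_not _ _
  have hNnodup : N.Nodup := by
    rw [Multiset.nodup_iff_count_le_one]
    intro l
    by_cases hl : l ∈ N
    · have h1 := Multiset.mem_filter.1 hl
      exact (Multiset.count_le_of_le l (Multiset.filter_le _ _)).trans (hcount l h1.1 h1.2).le
    · rw [Multiset.count_eq_zero_of_notMem hl]
      exact zero_le_one
  have hdprod : d = (S.map fun l => Polynomial.X - Polynomial.C l).prod
      * ∏ l ∈ N.toFinset, (Polynomial.X - Polynomial.C l) := by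
    conv_lhs => rw [hsplit, ← hSN, Multiset.map_add, Multiset.prod_add]
    congr 1
    rw [Finset.prod_eq_multiset_prod, Multiset.toFinset_val, hNnodup.dedup]
  have hd0 : Polynomial.aeval Ac d = 0 := by
    have h1 := h.aeval_denom_eq_zero
    have h2 := congrArg (fun P : Matrix (Fin n) (Fin n) ℝ => P.map (algebraMap ℝ ℂ)) h1
    have h3 : (Polynomial.aeval A H.denom).map (algebraMap ℝ ℂ) = Polynomial.aeval Ac H.denom :=
      (Polynomial.aeval_algHom_apply (Algebra.ofId ℝ ℂ).mapMatrix A H.denom).symm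
    rw [hd, Polynomial.aeval_map_algebraMap, ← h3]
    simpa using h2
  have hI := hG.aeval_eq_zero_of_re_neg (∏ l ∈ N.toFinset, (Polynomial.X - Polynomial.C l)) S
    (fun l hl => (Multiset.mem_filter.1 hl).2) (fun s => by
      rw [← hdprod, hd0, Matrix.zero_mulVec])
  obtain ⟨w, hw⟩ := hG.exists_eq_sum_exp N.toFinset hI
  have hg : ∀ l : ℂ, ∃ g : Unit ⊕ Fin m ⊕ Fin m → ℝ, l ∈ N.toFinset → ∀ s : ℝ,
      (Complex.exp (l * s) * ((fun i => (C i : ℂ)) ⬝ᵥ w l)).re = ∑ j, regressor ω s j * g j := by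
    intro l
    by_cases hl : l ∈ N.toFinset
    · have h1 := Multiset.mem_filter.1 (Multiset.mem_toFinset.1 hl)
      obtain ⟨g, hg⟩ := exists_regressor_mode ω ((himag l h1.1 h1.2).imp_left And.right)
        ((fun i => (C i : ℂ)) ⬝ᵥ w l)
      exact ⟨g, fun _ => hg⟩
    · exact ⟨0, fun h => absurd h hl⟩
  choose g hg using hg
  refine ⟨fun j => ∑ l ∈ N.toFinset, g l j, fun s => ?_⟩
  have hout : C ⬝ᵥ flow A s v = ((fun i => (C i : ℂ)) ⬝ᵥ G s).re := by
    simp [dotProduct, G]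
  rw [hout, hw, dotProduct_sum, Complex.re_sum]
  simp only [Finset.mul_sum]
  rw [Finset.sum_comm]
  refine Finset.sum_congr rfl fun l hl => ?_
  rw [dotProduct_smul, smul_eq_mul, hg l hl]

/-- The pole has an eigenvector with nonzero output `c`; the real part of its exponential motion,
scaled by `b / c`, is the solution. -/
theorem IsMinimalRealization.exists_solution_mode (h : IsMinimalRealization H A B C D) {s : ℂ}
    (hs : IsPole H s) (b : ℂ) : ∃ z : ℝ → Fin n → ℝ, (∀ t, HasDerivAt z (A *ᵥ z t) t) ∧
      ∀ t : ℝ, C ⬝ᵥ z t = (b * Complex.exp (s * t)).re := by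
  obtain ⟨w, hw, hCw⟩ := h.exists_eigenvector (isPole_iff.1 hs)
  set c := (fun i => (C i : ℂ)) ⬝ᵥ w with hc
  refine ⟨fun t i => (b / c * Complex.exp (s * t) * w i).re, fun t => ?_, fun t => ?_⟩
  · rw [hasDerivAt_pi]
    intro i
    have h1 : HasDerivAt (fun t : ℝ => s * (t : ℂ)) s t := by
      simpa using (Complex.ofRealCLM.hasDerivAt (x := t)).const_mul s
    have h2 := (h1.cexp.const_mul (b / c)).mul_const (w i)
    have h3 := Complex.reCLM.hasFDerivAt.comp_hasDerivAt t h2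
    refine h3.congr_deriv ?_
    have h4 := congrFun hw i
    simp only [Matrix.mulVec, dotProduct, Matrix.map_apply, Pi.smul_apply, smul_eq_mul] at h4 ⊢
    have h5 : b / c * (Complex.exp (s * t) * s) * w i
        = ∑ j, (A i j : ℂ) * (b / c * Complex.exp (s * t) * w j) := by
      calc b / c * (Complex.exp (s * t) * s) * w i
          = b / c * Complex.exp (s * t) * (s * w i) := by ring
        _ = _ := by
            rw [← h4, Finset.mul_sum]
            refine Finset.sum_congr rfl fun j _ => ?_
            rw [Complex.coe_algebraMap]
            ring
    rw [Complex.reCLM_apply, h5, Complex.re_sum]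
    refine Finset.sum_congr rfl fun j _ => ?_
    rw [Complex.re_ofReal_mul]
  · have h1 : b * Complex.exp (s * t) = ∑ i, (C i : ℂ) * (b / c * Complex.exp (s * t) * w i) := by
      have h2 : ∑ i, (C i : ℂ) * (b / c * Complex.exp (s * t) * w i)
          = b / c * Complex.exp (s * t) * c := by
        rw [hc, dotProduct, Finset.mul_sum]
        refine Finset.sum_congr rfl fun j _ => ?_
        ring
      rw [h2]
      field_simp
    rw [h1, Complex.re_sum, dotProduct]
    refine Finset.sum_congr rfl fun j _ => ?_
    rw [Complex.re_ofReal_mul]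

/-- The reference is the output of a free motion. -/
theorem IsMinimalRealization.exists_solution_reference (h : IsMinimalRealization H A B C D)
    {m : ℕ} {a ω θ : Fin m → ℝ} {δ₀ a₀ : ℝ} (hδ₀ : δ₀ = 0 ∨ δ₀ = 1) (hpole_zero : δ₀ = 1 → IsPole H 0)
    (hpole_freq : ∀ i, IsPole H (Complex.I * (ω i : ℂ))) :
    ∃ z : ℝ → Fin n → ℝ, (∀ t, HasDerivAt z (A *ᵥ z t) t) ∧
      ∀ t : ℝ, C ⬝ᵥ z t = reference δ₀ a₀ a ω θ t := by
  have h0 : ∃ z : ℝ → Fin n → ℝ, (∀ t, HasDerivAt z (A *ᵥ z t) t) ∧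
      ∀ t : ℝ, C ⬝ᵥ z t = δ₀ * a₀ := by
    rcases hδ₀ with rfl | rfl
    · exact ⟨fun _ => 0, fun t => by simpa using hasDerivAt_const t (0 : Fin n → ℝ), by simp⟩
    · obtain ⟨z, hz, hC⟩ := h.exists_solution_mode (hpole_zero rfl) a₀
      exact ⟨z, hz, fun t => by rw [hC]; simp⟩
  have hi : ∀ i, ∃ z : ℝ → Fin n → ℝ, (∀ t, HasDerivAt z (A *ᵥ z t) t) ∧
      ∀ t : ℝ, C ⬝ᵥ z t = a i * Real.sin (ω i * t + θ i) := by
    intro i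
    -- `a sin (ω t + θ)` is the real part of `-j a exp(jθ) exp(jωt)`.
    obtain ⟨z, hz, hC⟩ := h.exists_solution_mode (hpole_freq i)
      (-Complex.I * a i * Complex.exp (θ i * Complex.I))
    refine ⟨z, hz, fun t => ?_⟩
    rw [hC, mul_assoc, ← Complex.exp_add]
    have : (θ i : ℂ) * Complex.I + Complex.I * ω i * t = ((ω i * t + θ i : ℝ) : ℂ) * Complex.I := by
      push_cast
      ring
    rw [this, Complex.mul_re, Complex.exp_ofReal_mul_I_re, Complex.exp_ofReal_mul_I_im]
    simp
  obtain ⟨z₀, hz₀, hC₀⟩ := h0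
  choose z hz hC using hi
  refine ⟨fun t => z₀ t + ∑ i, z i t, fun t => ?_, fun t => ?_⟩
  · have := (hz₀ t).add (HasDerivAt.fun_sum (u := Finset.univ) fun i _ => hz i t)
    refine this.congr_deriv ?_
    rw [Matrix.mulVec_add, Matrix.mulVec_sum]
  · rw [dotProduct_add, dotProduct_sum, hC₀, reference]
    simp only [hC]

end Spectral

/-! ### Limit points of the sampled deviation -/

section Limit

variable {n : ℕ} (A : Matrix (Fin n) (Fin n) ℝ)

/-- Limit points of a bounded sequence that is asymptotically generated by the time-`T` map of a
linear flow have bounded orbits. -/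
theorem flow_bounded_of_tendsto {T : ℝ} (hT : 0 < T) {v : ℕ → Fin n → ℝ} {R : ℝ}
    (hv : ∀ k, ‖v k‖ ≤ R) (hstep : Tendsto (fun k => v (k + 1) - flow A T (v k)) atTop (𝓝 0))
    {ks : ℕ → ℕ} (hks : Tendsto ks atTop atTop) {a : Fin n → ℝ}
    (ha : Tendsto (fun i => v (ks i)) atTop (𝓝 a)) :
    (∃ M, ∀ s, ‖flow A s a‖ ≤ M) ∧
      Tendsto (fun i => v (ks i - 1)) atTop (𝓝 (flow A (-T) a)) := by
  have hj : ∀ j : ℕ, Tendsto (fun k => v (k + j) - flow A (j * T) (v k)) atTop (𝓝 0) := by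
    intro j
    induction j with
    | zero => simp [flow_zero]
    | succ j ih =>
      have h1 := (hstep.comp (tendsto_add_atTop_nat j)).add
        (((flow A T).continuous.tendsto 0).comp ih)
      rw [map_zero, add_zero] at h1
      refine h1.congr fun k => ?_
      have e : ((j + 1 : ℕ) : ℝ) * T = T + j * T := by push_cast; ring
      simp only [Function.comp_apply, map_sub, e, flow_add_apply]
      rw [← add_assoc k j 1]
      abel
  have hfwd : ∀ j : ℕ, ‖flow A (j * T) a‖ ≤ R := by
    intro j
    have h1 := ((hj j).comp hks).add (((flow A (j * T)).continuous.tendsto a).comp ha)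
    rw [zero_add] at h1
    refine le_of_tendsto h1.norm (Eventually.of_forall fun i => ?_)
    simp only [Function.comp_apply, sub_add_cancel]
    exact hv _
  -- The orbit of `a` is reached backwards through the earlier terms of the same sequence. The
  -- truncated subtraction is harmless because eventually `ks i ≥ j`.
  have hbwd : ∀ j : ℕ, Tendsto (fun i => v (ks i - j)) atTop (𝓝 (flow A (-(j * T)) a)) := by
    intro j
    have h1 := ha.sub ((hj j).comp ((tendsto_sub_atTop_nat j).comp hks))
    rw [sub_zero] at h1
    have h2 := ((flow A (-(j * T))).continuous.tendsto a).comp h1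
    refine h2.congr' ?_
    filter_upwards [hks.eventually_ge_atTop j] with i hi
    simp only [Function.comp_apply, Nat.sub_add_cancel hi, sub_sub_cancel, flow_neg_apply_flow]
  refine ⟨?_, by simpa using hbwd 1⟩
  obtain ⟨M, hM0, hM⟩ := exists_norm_flow_le A T
  have hint : ∀ j : ℤ, ‖flow A (j * T) a‖ ≤ R := by
    intro j
    obtain ⟨k, rfl | rfl⟩ := j.eq_nat_or_neg
    · simpa using hfwd k
    · have := le_of_tendsto (hbwd k).norm (Eventually.of_forall fun i => hv _)
      simpa using this
  refine ⟨M * R, fun s => ?_⟩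
  have hs : s = Int.fract (s / T) * T + ⌊s / T⌋ * T := by
    rw [← add_mul, Int.fract_add_floor]
    field_simp
  rw [hs, flow_add_apply]
  refine (flow A _).le_of_opNorm_le_of_le (hM _ ?_) (hint _)
  rw [abs_of_nonneg (mul_nonneg (Int.fract_nonneg _) hT.le)]
  exact mul_le_of_le_one_left hT.le (Int.fract_lt_one _).le

variable {A}

/-- Differentiating the vanishing output `k` times at `0` gives `C A ^ k v = 0`. -/
theorem IsMinimalRealization.eq_zero_of_output_flow_eq_zero {H : RatFunc ℝ} {B C : Fin n → ℝ}
    {D : ℝ} (h : IsMinimalRealization H A B C D) {v : Fin n → ℝ}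
    (hv : ∀ s, C ⬝ᵥ flow A s v = 0) : v = 0 := by
  refine h.eq_zero_of_unobservable fun k => ?_
  have key : ∀ (k : ℕ) (s : ℝ), C ⬝ᵥ (A ^ k *ᵥ flow A s v) = 0 := by
    intro k
    induction k with
    | zero => simpa using hv
    | succ k ih =>
      intro s
      let L : (Fin n → ℝ) →L[ℝ] ℝ :=
        (dotProductBilin ℝ ℝ C ∘ₗ (A ^ k).mulVecLin).toContinuousLinearMap
      have h1 : HasDerivAt (fun s => C ⬝ᵥ (A ^ k *ᵥ flow A s v))
          (C ⬝ᵥ (A ^ k *ᵥ (A *ᵥ flow A s v))) s :=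
        L.hasFDerivAt.comp_hasDerivAt s (hasDerivAt_flow_apply A v s)
      simp only [ih] at h1
      rw [pow_succ, ← Matrix.mulVec_mulVec]
      exact h1.unique (hasDerivAt_const s 0)
  simpa [flow_zero] using key k 0

theorem eq_zero_of_crossingMatrix_rank {m : ℕ} {Δ T : ℝ} {ω : Fin m → ℝ} {r : ℝ → ℝ}
    (h : (crossingMatrix Δ T ω r).rank = 2 * m + 1) {g : Unit ⊕ Fin m ⊕ Fin m → ℝ}
    (hg : ∀ t ∈ crossingTimes Δ T r, ∑ j, regressor ω t j * g j = 0) : g = 0 := by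
  have h1 := LinearMap.finrank_range_add_finrank_ker (crossingMatrix Δ T ω r).mulVecLin
  rw [Matrix.rank] at h
  rw [h, Module.finrank_fintype_fun_eq_card] at h1
  simp only [Fintype.card_sum, Fintype.card_unit, Fintype.card_fin] at h1
  have h2 : Module.finrank ℝ (LinearMap.ker (crossingMatrix Δ T ω r).mulVecLin) = 0 := by omega
  have h3 : g ∈ LinearMap.ker (crossingMatrix Δ T ω r).mulVecLin := by
    rw [LinearMap.mem_ker]
    ext t
    exact hg t t.2
  rw [Submodule.finrank_eq_zero.1 h2] at h3
  exact (Submodule.mem_bot ℝ).1 h3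

end Limit

/-! ### The deviation from the reference motion near crossing times -/

section Loop

variable {n : ℕ} {A : Matrix (Fin n) (Fin n) ℝ} {B C : Fin n → ℝ} {D : ℝ}

theorem abs_dotProduct_le (C v : Fin n → ℝ) : |C ⬝ᵥ v| ≤ (∑ i, |C i|) * ‖v‖ := by
  rw [dotProduct, Finset.sum_mul]
  refine (Finset.abs_sum_le_sum_abs _ _).trans (Finset.sum_le_sum fun i _ => ?_)
  rw [abs_mul]
  exact mul_le_mul_of_nonneg_left (norm_le_pi_norm v i) (abs_nonneg _)

/-- The deviation from the reference motion solves the state equation with input `-u`. -/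
theorem IsLoopSolution.deviation_eq {Δ : ℝ} {r : ℝ → ℝ} {x : ℝ → Fin n → ℝ} {u y : ℝ → ℝ}
    (h : IsLoopSolution Δ r A B C D x u y) {z : ℝ → Fin n → ℝ}
    (hz : ∀ t, HasDerivAt z (A *ᵥ z t) t) {t : ℝ} (ht : 0 ≤ t) :
    z t - x t = z 0 - x 0 + ∫ s in (0 : ℝ)..t, (A *ᵥ (z s - x s) - u s • B) := by
  have hzc : Continuous z := continuous_iff_continuousAt.2 fun s => (hz s).continuousAt
  have hAz : IntervalIntegrable (fun s => A *ᵥ z s) volume 0 t :=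
    Continuous.intervalIntegrable (by fun_prop) _ _
  have h1 := intervalIntegral.integral_eq_sub_of_hasDerivAt (fun s _ => hz s) hAz
  have hAx : IntervalIntegrable (fun s => A *ᵥ x s) volume 0 t := by
    refine ContinuousOn.intervalIntegrable ?_
    rw [Set.uIcc_of_le ht]
    exact (A.mulVecLin.toContinuousLinearMap.continuous.comp_continuousOn
      h.continuousOn_state).mono fun s hs => hs.1
  have huB : IntervalIntegrable (fun s => u s • B) volume 0 t :=
    ⟨(h.intervalIntegrable_error t ht).1.smul_const B,
      (h.intervalIntegrable_error t ht).2.smul_const B⟩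
  have h2 := h.state_eq t ht
  have h3 : ∫ s in (0 : ℝ)..t, (A *ᵥ (z s - x s) - u s • B)
      = (∫ s in (0 : ℝ)..t, A *ᵥ z s) - ∫ s in (0 : ℝ)..t, (A *ᵥ x s + u s • B) := by
    rw [← intervalIntegral.integral_sub hAz (hAx.add huB)]
    refine intervalIntegral.integral_congr fun s _ => ?_
    simp only [Matrix.mulVec_sub]
    abel
  rw [h3, h1, h2]
  abel

/-- If the motion is asymptotically free along a sequence of periods and the quantized error tends
to zero in the mean, then the limiting output vanishes at the crossing times. -/
theorem output_flow_eq_zero_of_crossing {Δ T : ℝ} (hΔ : 0 < Δ) (hD : 0 ≤ D)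
    {r : ℝ → ℝ} (hr : Continuous r) (hper : Function.Periodic r T) {ξ : ℝ → Fin n → ℝ}
    {u y : ℝ → ℝ} (hu : ∀ t : ℝ, 0 ≤ t → IntervalIntegrable u volume 0 t)
    (hmem : ∀ t : ℝ, 0 ≤ t → ∃ v ∈ filledQuantizer Δ (y t), u t = quantizer Δ (r t) - v)
    (hout : ∀ t : ℝ, 0 ≤ t → r t - y t = C ⬝ᵥ ξ t - D * u t) {ks : ℕ → ℕ} {b : Fin n → ℝ}
    {w : ℕ → ℝ} (hw : Tendsto w atTop (𝓝 0))
    (hwξ : ∀ i, ∀ s ∈ Set.Icc 0 (2 * T), ‖ξ (ks i * T + s) - flow A s b‖ ≤ w i)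
    (hwu : ∀ i, ∫ s in (ks i * T : ℝ)..(ks i * T + 2 * T), |u s| ≤ w i)
    {τ : ℝ} (hτ : τ ∈ crossingTimes Δ T r) : C ⬝ᵥ flow A (T + τ) b = 0 := by
  obtain ⟨⟨hτ0, hτT⟩, hcross⟩ := hτ
  have hT : 0 < T := hτ0.trans_lt hτT
  by_contra hc
  set c := C ⬝ᵥ flow A (T + τ) b with hcdef
  have hc' : 0 < |c| := abs_pos.2 hc
  have hcont : Continuous fun s => C ⬝ᵥ flow A (T + s) b := by
    have h1 : Continuous fun s => flow A (T + s) b :=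
      ((continuous_flow A).clm_apply continuous_const).comp (by fun_prop)
    exact Continuous.dotProduct continuous_const h1
  -- The crossing is looked at one period later, at `T + τ`, so that a left neighbourhood is
  -- available inside `[0, 2T]` even for `τ = 0`.
  obtain ⟨ε, hε, hεc⟩ := Metric.continuous_iff.1 hcont τ (|c| / 4) (by positivity)
  obtain ⟨κ, hκ, α, β, hαβ, hsub, hκs⟩ := hcross.exists_abs_ge hΔ hr hD hc
    (lt_min hε (lt_min hT (sub_pos.2 hτT)))
  have hin : ∀ s ∈ Set.Ioo α β, |s - τ| < ε ∧ -T ≤ s ∧ s ≤ T := by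
    intro s hs
    have h1 := hsub hs
    rw [Metric.mem_ball, Real.dist_eq, lt_min_iff, lt_min_iff] at h1
    have h2 := abs_lt.1 h1.2.1
    have h3 := abs_lt.1 h1.2.2
    exact ⟨h1.1, by linarith, by linarith⟩
  have hα : -T ≤ α := by
    refine le_of_forall_gt_imp_ge_of_dense fun s hs => ?_
    rcases lt_or_ge s β with h | h
    · exact (hin s ⟨hs, h⟩).2.1
    · have := (hin ((α + β) / 2) ⟨by linarith, by linarith⟩).2.1
      linarith
  have hβ : β ≤ T := by
    refine le_of_forall_lt_imp_le_of_dense fun s hs => ?_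
    rcases lt_or_ge α s with h | h
    · exact (hin s ⟨h, hs⟩).2.2
    · have := (hin ((α + β) / 2) ⟨by linarith, by linarith⟩).2.2
      linarith
  set Cn := ∑ i, |C i| with hCn
  have hw1 : Tendsto (fun i => Cn * w i) atTop (𝓝 0) := by simpa using hw.const_mul Cn
  -- Late enough, the deviation is so close to the free motion that its output stays within `|c| /
  -- 2` of `c`, while the integral of `|u|` is below `κ (β - α)`. These are incompatible.
  obtain ⟨i, hi1, hi2⟩ := ((hw1.eventually (gt_mem_nhds (by positivity : 0 < |c| / 4))).and
    (hw.eventually (gt_mem_nhds (mul_pos hκ (sub_pos.2 hαβ))))).exists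
  have hk0 : (0 : ℝ) ≤ ks i * T := by positivity
  have hlow : ∀ s ∈ Set.Ioo (ks i * T + T + α) (ks i * T + T + β), κ ≤ |u s| := by
    intro s hs
    obtain ⟨σ, rfl⟩ : ∃ σ, s = ks i * T + (T + σ) := ⟨s - ks i * T - T, by ring⟩
    have hσ : σ ∈ Set.Ioo α β := ⟨by linarith [hs.1], by linarith [hs.2]⟩
    obtain ⟨hσ1, hσ2, hσ3⟩ := hin σ hσ
    have ht0 : 0 ≤ ks i * T + (T + σ) := by linarith
    obtain ⟨v, hv, huv⟩ := hmem _ ht0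
    have hrs : r (ks i * T + (T + σ)) = r σ := by
      have h1 := hper.nat_mul (ks i + 1) σ
      rw [← h1]
      congr 1
      push_cast
      ring
    have ho := hout _ ht0
    rw [hrs] at huv ho
    rw [huv] at ho ⊢
    refine hκs σ hσ _ v _ hv ho ?_
    have h1 := hwξ i (T + σ) ⟨by linarith, by linarith⟩
    have h2 := hεc σ hσ1
    rw [Real.dist_eq] at h2
    have h3 : |C ⬝ᵥ ξ (ks i * T + (T + σ)) - C ⬝ᵥ flow A (T + σ) b| ≤ Cn * w i := by
      rw [← dotProduct_sub]
      exact (abs_dotProduct_le _ _).trans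
        (mul_le_mul_of_nonneg_left h1 (Finset.sum_nonneg fun i _ => abs_nonneg _))
    have h4 := abs_sub_le (C ⬝ᵥ ξ (ks i * T + (T + σ))) (C ⬝ᵥ flow A (T + σ) b) c
    linarith
  have hint : ∀ a b : ℝ, 0 ≤ a → 0 ≤ b → IntervalIntegrable (fun s => |u s|) volume a b :=
    fun a b ha hb => (intervalIntegrable_of_nonneg hu ha hb).abs
  have h1 : κ * (β - α) ≤ ∫ s in (ks i * T + T + α)..(ks i * T + T + β), |u s| := by
    have h2 := intervalIntegral.integral_mono_on_of_le_Ioo (μ := volume)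
      (by linarith : ks i * T + T + α ≤ ks i * T + T + β)
      (intervalIntegrable_const (c := κ)) (hint _ _ (by linarith) (by linarith)) hlow
    rw [intervalIntegral.integral_const, smul_eq_mul] at h2
    linarith
  have h2 : ∫ s in (ks i * T + T + α)..(ks i * T + T + β), |u s|
      ≤ ∫ s in (ks i * T : ℝ)..(ks i * T + 2 * T), |u s| :=
    intervalIntegral.integral_mono_interval (by linarith) (by linarith) (by linarith)
      (ae_of_all _ fun s => abs_nonneg _) (hint _ _ hk0 (by linarith))
  linarith [hwu i]

end Loop

/-! ### The energy estimate for the closed loop -/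

section Boundedness

variable {n : ℕ} {A : Matrix (Fin n) (Fin n) ℝ} {B C : Fin n → ℝ} {D : ℝ}

/-- A solution of the loop stays bounded relative to the reference motion, and the energy extracted
from the linear system is bounded. -/
theorem IsLoopSolution.deviation_bounded {Δ : ℝ} (hΔ : 0 < Δ) {r : ℝ → ℝ} {x : ℝ → Fin n → ℝ}
    {u y : ℝ → ℝ} (h : IsLoopSolution Δ r A B C D x u y) {z : ℝ → Fin n → ℝ}
    (hz : ∀ t, HasDerivAt z (A *ᵥ z t) t) (hCz : ∀ t, C ⬝ᵥ z t = r t) (hD : 0 ≤ D)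
    {β : LinearMap.BilinForm ℝ (Fin n → ℝ)} (hsymm : ∀ x y, β x y = β y x)
    (hpos : ∀ x, x ≠ 0 → 0 < β x x)
    (hdiss : ∀ (z : Fin n → ℝ) (c : ℝ), β z (A *ᵥ z + c • B) ≤ c * (C ⬝ᵥ z + D * c)) :
    (∃ R, ∀ t : ℝ, 0 ≤ t → ‖z t - x t‖ ≤ R) ∧
    (∀ t : ℝ, 0 ≤ t → IntervalIntegrable (fun s => (r s - y s) * u s) volume 0 t) ∧
    ∃ K, ∀ t : ℝ, 0 ≤ t → ∫ s in (0 : ℝ)..t, (r s - y s) * u s ≤ K := by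
  have hzc : Continuous z := continuous_iff_continuousAt.2 fun s => (hz s).continuousAt
  have hξc : ContinuousOn (fun t => z t - x t) (Set.Ici 0) :=
    hzc.continuousOn.sub h.continuousOn_state
  have hout : ∀ t : ℝ, 0 ≤ t → r t - y t = C ⬝ᵥ (z t - x t) - D * u t := by
    intro t ht
    rw [dotProduct_sub, hCz, h.output_eq t ht]
    ring
  have hp0 : ∀ t : ℝ, 0 ≤ t → 0 ≤ (r t - y t) * u t := by
    intro t ht
    obtain ⟨v, hv, huv⟩ := h.error_mem t ht
    rw [huv]
    exact mul_quantizer_sub_nonneg hΔ hv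
  have hCξc : ContinuousOn (fun t => C ⬝ᵥ (z t - x t)) (Set.Ici 0) :=
    (dotProductBilin ℝ ℝ C).toContinuousLinearMap.continuous.comp_continuousOn hξc
  -- Square integrability of `u` is not among the assumptions. Integrability comes from `0 ≤ e u ≤
  -- (C ξ) u`, as `(C ξ) u = e u + D u ^ 2`.
  have hpi : ∀ t : ℝ, 0 ≤ t → IntervalIntegrable (fun s => (r s - y s) * u s) volume 0 t := by
    intro t ht
    have hsub : Set.uIoc 0 t ⊆ Set.Ici 0 := by
      rw [Set.uIoc_of_le ht]
      exact fun s hs => hs.1.le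
    have hui := h.intervalIntegrable_error t ht
    have hg : IntervalIntegrable (fun s => C ⬝ᵥ (z s - x s) * u s) volume 0 t := by
      refine hui.continuousOn_mul (hCξc.mono ?_)
      rw [Set.uIcc_of_le ht]
      exact fun s hs => hs.1
    have hum := (intervalIntegrable_iff.1 hui).aestronglyMeasurable
    have hgm := (intervalIntegrable_iff.1 hg).aestronglyMeasurable
    have hpm : AEStronglyMeasurable (fun s => (r s - y s) * u s)
        (volume.restrict (Set.uIoc 0 t)) := by
      refine (hgm.sub ((hum.mul hum).const_mul D)).congr ?_
      filter_upwards [ae_restrict_mem measurableSet_uIoc] with s hs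
      simp only [Pi.sub_apply, Pi.mul_apply]
      rw [hout s (hsub hs)]
      ring
    refine hg.mono_fun hpm ?_
    filter_upwards [ae_restrict_mem measurableSet_uIoc] with s hs
    have h1 := hp0 s (hsub hs)
    have h2 : C ⬝ᵥ (z s - x s) * u s = (r s - y s) * u s + D * (u s * u s) := by
      rw [hout s (hsub hs)]
      ring
    have h3 := mul_nonneg hD (mul_self_nonneg (u s))
    rw [h2, Real.norm_of_nonneg h1, Real.norm_of_nonneg (by linarith)]
    linarith
  have hstor : ∀ t : ℝ, 0 ≤ t → β (z t - x t) (z t - x t)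
      + 2 * ∫ s in (0 : ℝ)..t, (r s - y s) * u s ≤ β (z 0 - x 0) (z 0 - x 0) := by
    intro t ht
    have hAξ : IntervalIntegrable (fun s => A *ᵥ (z s - x s)) volume 0 t := by
      refine ContinuousOn.intervalIntegrable ?_
      rw [Set.uIcc_of_le ht]
      exact (A.mulVecLin.toContinuousLinearMap.continuous.comp_continuousOn hξc).mono
        fun s hs => hs.1
    have huB : IntervalIntegrable (fun s => u s • B) volume 0 t :=
      ⟨(h.intervalIntegrable_error t ht).1.smul_const B,
        (h.intervalIntegrable_error t ht).2.smul_const B⟩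
    refine storage_le (ξ := fun t => z t - x t) β hsymm ht (hAξ.sub huB) (hpi t ht)
      (fun s hs => h.deviation_eq hz hs.1) fun s hs => ?_
    -- With input `-u` the output of the deviation is `e`, so the supplied power is `-e u`.
    have h1 := hdiss (z s - x s) (-u s)
    rw [neg_smul, ← sub_eq_add_neg] at h1
    refine h1.trans (le_of_eq ?_)
    rw [hout s hs.1]
    ring
  have hint0 : ∀ t : ℝ, 0 ≤ t → 0 ≤ ∫ s in (0 : ℝ)..t, (r s - y s) * u s := fun t ht =>
    intervalIntegral.integral_nonneg ht fun s hs => hp0 s hs.1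
  have hβ0 : ∀ w, 0 ≤ β w w := by
    intro w
    rcases eq_or_ne w 0 with rfl | hw
    · simp
    · exact (hpos w hw).le
  obtain ⟨c, hc, hcβ⟩ := exists_pos_mul_norm_sq_le β hpos
  refine ⟨⟨Real.sqrt (β (z 0 - x 0) (z 0 - x 0) / c), fun t ht => ?_⟩, hpi,
    ⟨β (z 0 - x 0) (z 0 - x 0) / 2, fun t ht => ?_⟩⟩
  · refine Real.le_sqrt_of_sq_le ?_
    rw [le_div_iff₀' hc]
    linarith [hcβ (z t - x t), hstor t ht, hint0 t ht]
  · linarith [hstor t ht, hβ0 (z t - x t)]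

end Boundedness

end QuantTracking

theorem theorem1
    -- quantization interval
    (Δ : ℝ) (hΔ : 0 < Δ)
    -- reference
    (m : ℕ) (hm : 1 ≤ m) (δ₀ a₀ : ℝ) (hδ₀ : δ₀ = 0 ∨ δ₀ = 1)
    (a ω θ : Fin m → ℝ) (ha : ∀ i, a i ≠ 0) (hω : ∀ i, 0 < ω i)
    (r : ℝ → ℝ) (hr : r = QuantTracking.reference δ₀ a₀ a ω θ)
    (T : ℝ) (href : QuantTracking.ReferenceCondition Δ T ω r)
    -- controller, plant and open-loop transfer function
    (Ctrl G H : RatFunc ℝ) (hH : H = Ctrl * G)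
    (hpole_zero : δ₀ = 1 → QuantTracking.IsSimplePole H 0)
    (hpole_freq : ∀ i, QuantTracking.IsSimplePole H (Complex.I * (ω i : ℂ)) ∧
      QuantTracking.IsSimplePole H (-(Complex.I * (ω i : ℂ))))
    (hpole_other : ∀ s : ℂ, QuantTracking.IsPole H s → ¬ (δ₀ = 1 ∧ s = 0) →
      (∀ i, s ≠ Complex.I * (ω i : ℂ) ∧ s ≠ -(Complex.I * (ω i : ℂ))) → s.re < 0)
    (hPR : QuantTracking.PositiveReal H)
    -- minimal realization of the open loop and solution of the closed loop
    (n : ℕ) (A : Matrix (Fin n) (Fin n) ℝ) (B C : Fin n → ℝ) (D : ℝ)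
    (hmin : QuantTracking.IsMinimalRealization H A B C D)
    (x : ℝ → Fin n → ℝ) (u y : ℝ → ℝ)
    (hsol : QuantTracking.IsLoopSolution Δ r A B C D x u y) :
    Filter.Tendsto (fun t => r t - y t) Filter.atTop (nhds 0) := by
  open QuantTracking in
  have hT := href.period_pos
  have hrc : Continuous r := hr ▸ continuous_reference
  have hra : AnalyticOnNhd ℝ r Set.univ := hr ▸ analyticOnNhd_reference
  obtain ⟨z, hz, hCz⟩ := hmin.exists_solution_reference (a := a) (ω := ω) (θ := θ) (a₀ := a₀) hδ₀
    (fun h => by rw [IsPole, hpole_zero h]; exact one_ne_zero)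
    (fun i => by rw [IsPole, (hpole_freq i).1]; exact one_ne_zero)
  rw [← hr] at hCz
  obtain ⟨hD, β, hsymm, hpos, hdiss⟩ := hmin.exists_storage hPR
  obtain ⟨⟨R, hR⟩, hpi, K, hK⟩ := hsol.deviation_bounded hΔ hz hCz hD hsymm hpos hdiss
  have hu := hsol.intervalIntegrable_error
  set ξ : ℝ → Fin n → ℝ := fun t => z t - x t with hξ
  have hξc : ContinuousOn ξ (Set.Ici 0) :=
    (continuous_iff_continuousAt.2 fun s => (hz s).continuousAt).continuousOn.sub
      hsol.continuousOn_state
  have hout : ∀ t : ℝ, 0 ≤ t → r t - y t = C ⬝ᵥ ξ t - D * u t := by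
    intro t ht
    rw [hξ, dotProduct_sub, hCz, hsol.output_eq t ht]
    ring
  have hp0 : ∀ t : ℝ, 0 ≤ t → 0 ≤ (r t - y t) * u t := by
    intro t ht
    obtain ⟨v, hv, huv⟩ := hsol.error_mem t ht
    rw [huv]
    exact mul_quantizer_sub_nonneg hΔ hv
  have herr : ∀ t : ℝ, 0 ≤ t → |r t - y t| ≤ |C ⬝ᵥ ξ t| := by
    intro t ht
    have h1 : C ⬝ᵥ ξ t = (r t - y t) + D * u t := by rw [hout t ht]; ring
    rw [h1, ← sq_le_sq]
    -- `(e + D u) ^ 2 ≥ e ^ 2`, because `D e u ≥ 0`.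
    nlinarith [mul_nonneg hD (hp0 t ht), sq_nonneg (D * u t)]
  set Cn := ∑ i, |C i| with hCn
  have hCn0 : 0 ≤ Cn := Finset.sum_nonneg fun i _ => abs_nonneg _
  have hR0 : 0 ≤ R := (norm_nonneg _).trans (hR 0 le_rfl)
  have huM : ∀ t : ℝ, 0 ≤ t → |u t| ≤ Cn * R + Δ := by
    intro t ht
    obtain ⟨v, hv, huv⟩ := hsol.error_mem t ht
    have h1 := abs_quantizer_sub_le (z := r t) hΔ hv
    rw [← huv] at h1
    have h2 := (abs_dotProduct_le C (ξ t)).trans (mul_le_mul_of_nonneg_left (hR t ht) hCn0)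
    linarith [herr t ht]
  -- the quantized error tends to zero in the mean
  have hcross : (crossingTimes Δ T r).Nonempty := by
    rw [← Set.encard_ne_zero]
    intro h0
    have := href.card_le
    rw [h0] at this
    simp at this
  obtain ⟨τ₀, hτ₀⟩ := hcross
  have hwin := tendsto_integral_abs_window (δ := fun t => levelDist Δ (r t)) hT
    (fun t => by simp only [href.periodic t]) ((measurable_levelDist Δ).comp hrc.measurable)
    (ae_levelDist_pos hΔ hra (hτ₀.2.exists_ne hΔ)) hu hpi hp0 hK huM (fun t ht => by
      obtain ⟨v, hv, huv⟩ := hsol.error_mem t ht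
      rw [huv]
      exact mul_abs_quantizer_sub_le hΔ hv le_rfl)
  -- Two periods, to leave room on both sides of each crossing.
  set I : ℕ → ℝ := fun k => ∫ s in (k * T : ℝ)..(k * T + 2 * T), |u s| with hI
  have hk0 : ∀ k : ℕ, (0 : ℝ) ≤ k * T := fun k => by positivity
  have hI0 : Tendsto I atTop (𝓝 0) := by
    have h1 := hwin.add (hwin.comp (tendsto_add_atTop_nat 1))
    rw [add_zero] at h1
    refine h1.congr fun k => ?_
    have e1 : ((k + 1 : ℕ) : ℝ) * T = k * T + T := by push_cast; ring
    have e2 : (k : ℝ) * T + T + T = k * T + 2 * T := by ring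
    simp only [Function.comp_apply, hI, e1, e2]
    have hk := hk0 k
    exact intervalIntegral.integral_add_adjacent_intervals
      (intervalIntegrable_of_nonneg hu hk (by linarith)).abs
      (intervalIntegrable_of_nonneg hu (by linarith) (by linarith)).abs
  obtain ⟨K', hK'0, hK'⟩ := exists_norm_sub_flow_le A B (by positivity : 0 ≤ 2 * T)
  have happrox : ∀ (k : ℕ), ∀ s ∈ Set.Icc 0 (2 * T),
      ‖ξ (k * T + s) - flow A s (ξ (k * T))‖ ≤ K' * I k := fun k s hs =>
    hK' ξ u hξc hu (fun t ht => hsol.deviation_eq hz ht) _ (hk0 k) s hs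
  have hKI : Tendsto (fun k => K' * I k) atTop (𝓝 0) := by simpa using hI0.const_mul K'
  obtain ⟨M, hM0, hM⟩ := exists_norm_flow_le A (2 * T)
  have hstep : Tendsto (fun k : ℕ => ξ ((k + 1 : ℕ) * T) - flow A T (ξ (k * T))) atTop (𝓝 0) := by
    rw [tendsto_zero_iff_norm_tendsto_zero]
    refine squeeze_zero (fun _ => norm_nonneg _) (fun k => ?_) hKI
    have e : ((k + 1 : ℕ) : ℝ) * T = k * T + T := by push_cast; ring
    rw [e]
    exact happrox k T ⟨hT.le, by linarith⟩
  -- the state at multiples of the period tends to the reference motion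
  have hv : Tendsto (fun k : ℕ => ξ (k * T)) atTop (𝓝 0) := by
    refine tendsto_of_subseq_tendsto fun ns hns => ?_
    obtain ⟨b, -, φ, hφ, hb⟩ := tendsto_subseq_of_bounded
      (Metric.isBounded_closedBall (x := (0 : Fin n → ℝ)) (r := R))
      (x := fun i => ξ (ns i * T)) fun i => by
        rw [mem_closedBall_zero_iff]
        exact hR _ (hk0 _)
    have hks : Tendsto (fun i => ns (φ i)) atTop atTop := hns.comp hφ.tendsto_atTop
    obtain ⟨⟨M', hM'⟩, hb'⟩ := flow_bounded_of_tendsto A hT (v := fun k : ℕ => ξ (k * T))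
      (fun k => hR _ (hk0 k)) hstep hks hb
    obtain ⟨g, hg⟩ := hmin.exists_output_eq_regressor hpole_zero hpole_freq hpole_other hM'
    have hks1 : Tendsto (fun i => ns (φ i) - 1) atTop atTop :=
      (tendsto_sub_atTop_nat 1).comp hks
    -- The window starts one period earlier, which compensates for the crossings being observed at
    -- `T + τ`.
    set b' := flow A (-T) b with hb'def
    have hbn : Tendsto (fun i => ‖ξ (((ns (φ i) - 1 : ℕ) : ℝ) * T) - b'‖) atTop (𝓝 0) :=
      tendsto_iff_norm_sub_tendsto_zero.1 hb'
    let w : ℕ → ℝ := fun i => K' * I (ns (φ i) - 1) + I (ns (φ i) - 1)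
      + M * ‖ξ (((ns (φ i) - 1 : ℕ) : ℝ) * T) - b'‖
    have hw : Tendsto w atTop (𝓝 0) := by
      have := ((hKI.comp hks1).add (hI0.comp hks1)).add (hbn.const_mul M)
      simpa using this
    have hInn : ∀ k, 0 ≤ I k := fun k =>
      intervalIntegral.integral_nonneg (by linarith) fun s _ => abs_nonneg _
    have hzero : ∀ τ ∈ crossingTimes Δ T r, C ⬝ᵥ flow A τ b = 0 := by
      intro τ hτ
      have h1 := output_flow_eq_zero_of_crossing (C := C) (A := A) (ξ := ξ) (b := b')
        (ks := fun i => ns (φ i) - 1) hΔ hD hrc href.periodic hu hsol.error_mem hout hw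
        (fun i s hs => ?_) (fun i => ?_) hτ
      · rw [add_comm, flow_add_apply, hb'def, flow_apply_flow_neg] at h1
        exact h1
      · have h2 := happrox (ns (φ i) - 1) s hs
        have h3 : ‖flow A s (ξ (((ns (φ i) - 1 : ℕ) : ℝ) * T)) - flow A s b'‖
            ≤ M * ‖ξ (((ns (φ i) - 1 : ℕ) : ℝ) * T) - b'‖ := by
          rw [← map_sub]
          exact (flow A s).le_of_opNorm_le (hM s (by rw [abs_of_nonneg hs.1]; exact hs.2)) _
        have h4 := norm_sub_le_norm_sub_add_norm_sub (ξ (((ns (φ i) - 1 : ℕ) : ℝ) * T + s))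
          (flow A s (ξ (((ns (φ i) - 1 : ℕ) : ℝ) * T))) (flow A s b')
        linarith [hInn (ns (φ i) - 1)]
      · have h2 := mul_nonneg hK'0 (hInn (ns (φ i) - 1))
        have h3 := mul_nonneg hM0 (norm_nonneg (ξ (((ns (φ i) - 1 : ℕ) : ℝ) * T) - b'))
        change I (ns (φ i) - 1) ≤ w i
        linarith
    have hg0 : g = 0 := eq_zero_of_crossingMatrix_rank href.rank_eq fun τ hτ => by
      rw [← hg]
      exact hzero τ hτ
    have hb0 : b = 0 := hmin.eq_zero_of_output_flow_eq_zero fun s => by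
      rw [hg, hg0]
      simp
    exact ⟨φ, hb0 ▸ hb⟩
  -- between the multiples of the period the motion is almost free
  have hfloor : Tendsto (fun t : ℝ => ⌊t / T⌋₊) atTop atTop :=
    tendsto_nat_floor_atTop.comp (tendsto_id.atTop_div_const hT)
  have hbound : Tendsto (fun t : ℝ => Cn * (K' * I ⌊t / T⌋₊ + M * ‖ξ (⌊t / T⌋₊ * T)‖)) atTop
      (𝓝 0) := by
    have h1 := (tendsto_zero_iff_norm_tendsto_zero.1 hv).const_mul M
    have h2 := ((hKI.add h1).const_mul Cn).comp hfloor
    simpa [Function.comp_def] using h2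
  refine squeeze_zero_norm' ?_ hbound
  filter_upwards [eventually_ge_atTop 0] with t ht
  have hfl := Nat.floor_le (div_nonneg ht hT.le)
  have hfl2 := Nat.lt_floor_add_one (t / T)
  rw [le_div_iff₀ hT] at hfl
  rw [div_lt_iff₀ hT] at hfl2
  have hs : t - ⌊t / T⌋₊ * T ∈ Set.Icc 0 (2 * T) := ⟨by linarith, by linarith⟩
  have h1 := happrox ⌊t / T⌋₊ _ hs
  rw [add_sub_cancel] at h1
  have h2 : ‖flow A (t - ⌊t / T⌋₊ * T) (ξ (⌊t / T⌋₊ * T))‖ ≤ M * ‖ξ (⌊t / T⌋₊ * T)‖ :=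
    (flow A _).le_of_opNorm_le (hM _ (by rw [abs_of_nonneg hs.1]; exact hs.2)) _
  have h3 : ‖ξ t‖ ≤ K' * I ⌊t / T⌋₊ + M * ‖ξ (⌊t / T⌋₊ * T)‖ := by
    have := norm_le_norm_sub_add (ξ t) (flow A (t - ⌊t / T⌋₊ * T) (ξ (⌊t / T⌋₊ * T)))
    linarith
  exact (herr t ht).trans ((abs_dotProduct_le C (ξ t)).trans
    (mul_le_mul_of_nonneg_left h3 hCn0))
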